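/- **Proposition 5.1.** Let $M$ be a smooth ($C^\infty$) Hausdorff manifold of dimension $m$ without boundary. An *almost contact metric structure* on $M$ is a quadruple $(F,Z,\xi,\gamma)$ of a smooth field $F$ of endomorphisms of $TM$, a smooth vector field $Z$, a smooth $1$-form $\xi$ and a Riemannian metric $\gamma$ with $$F^2=-\mathrm{Id}+\xi\otimes Z,\quad \xi(Z)=1,\quad FZ=0,\quad \xi\circ F=0,\quad \gamma(FX,FY)=\gamma(X,Y)-\xi(X)\xi(Y).$$ Its fundamental form is $\Xi(X,Y)=\gamma(FX,Y)$. The structure is *normal* if for all smooth vector fields $X,Y$ $$[FX,FY]-F[FX,Y]-F[X,FY]+F^2[X,Y]=-d\xi(X,Y)\,Z,$$ where $d\xi(X,Y)=X(\xi(Y))-Y(\xi(X))-\xi([X,Y])$; it is *cosymplectic in the sense of Blair* if it is normal, $d\xi=0$ and $d\Xi=0$. For a manifold $N$, equip $TN\oplus T^*N$ with the neutral metric $g((X,\alpha),(Y,\beta))=\frac12(\alpha(Y)+\beta(X))$ and the Courant bracket $$[(X,\alpha),(Y,\beta)]=\bigl([X,Y],\,L_X\beta-L_Y\alpha+\tfrac12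 d(\alpha(Y)-\beta(X))\bigr).$$ A *generalized almost complex structure* on $N$ is a smooth $g$-skew-symmetric endomorphism $\Phi$ of $TN\oplus T^*N$ with $\Phi^2=-\mathrm{Id}$. It is *integrable* if the smooth sections of its $\sqrt{-1}$-eigenbundle in $(TN\oplus T^*N)\otimes\mathbb{C}$ are closed under the complex bilinear extension of the Courant bracket. A *generalized Riemannian metric* is a smooth positive definite metric $G$ on $TN\oplus T^*N$ such that the endomorphism $\sharp_G$ given by $2g(\sharp_G u,v)=G(u,v)$ is a $g$-isometry with $\sharp_G^2=\mathrm{Id}$. A pair $(G,\Phi)$ is a *generalized Kähler structure* if $G$ is a generalized Riemannian metric, $\Phi$ is a generalized almost complex structure with $G(\Phi u,v)+G(u,\Phi v)=0$, and both $\Phi$ and $\sharp_G\circ\Phi$ are integrable. A Riemannian metric $\Gamma$ on $N$ is regarded as the generalized Riemannian metric with $\sharp_G(X,\alpha)=(\sharp_\Gamma\alpha,\flat_\Gamma X)$, where $\flat_\Gamma X=\Gamma(X,\cdot)$ and $\sharp_\Gamma=\flat_\Gamma^{-1}$. Let $(F,Z,\xi,\gamma)$ be an almost contact metric structure on $M$,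 and let $t$ be the coordinate on $\mathbb{R}$. On $M\times\mathbb{R}$ let $\bar\Gamma=\gamma+dt^2$ and let $\Phi_0$ be the endomorphism of $T(M\times\mathbb{R})\oplus T^*(M\times\mathbb{R})$ $$\Phi_0(X,\alpha)=\bigl(FX+i(\alpha)\pi',\ i(X)\sigma'-\alpha\circ F\bigr),\qquad \pi'=Z\wedge\frac{\partial}{\partial t},\quad \sigma'=\xi\wedge dt,$$ where $F$ is extended by $F\frac{\partial}{\partial t}=0$, $Z$ and $\xi$ are extended in the obvious way, and $i(\alpha)(U\wedge V)=\alpha(U)V-\alpha(V)U$, $i(X)(\lambda\wedge\mu)=\lambda(X)\mu-\mu(X)\lambda$. Then $(\bar\Gamma,\Phi_0)$ is a generalized Kähler structure on $M\times\mathbb{R}$ if and only if $(F,Z,\xi,\gamma)$ is cosymplectic in the sense of Blair. -/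

import Mathlib

open scoped Manifold ContDiff

noncomputable section

namespace GenGeom

section Fields

/-! ### Smooth tensor fields, exterior differential, Lie derivative -/

variable {E : Type*} [NormedAddCommGroup E] [NormedSpace ℝ E]
  {H : Type*} [TopologicalSpace H] (I : ModelWithCorners ℝ E H)
  {M : Type*} [TopologicalSpace M] [ChartedSpace H M]

/-- The differential of a real function, as a `1`-form. -/
def dFun (f : M → ℝ) (x : M) : TangentSpace I x →L[ℝ] ℝ :=
  mfderiv I 𝓘(ℝ, ℝ) f x

/-- The expression of a `k`-form in the chart around `x₀` (pullback by the inverse chart). -/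
def chartForm {k : ℕ} (η : ∀ x : M, TangentSpace I x [⋀^Fin k]→L[ℝ] ℝ) (x₀ : M) (y : E) :
    E [⋀^Fin k]→L[ℝ] ℝ :=
  (η ((extChartAt I x₀).symm y)).compContinuousLinearMap
    (mfderivWithin 𝓘(ℝ, E) I (extChartAt I x₀).symm (Set.range I) y)

/-- The exterior differential `dη` of a `k`-form: at `x₀` it is the exterior derivative of the
expression of `η` in the chart around `x₀`, pulled back to `M` by this chart. There is no
normalizing factor: `dα(X, Y) = X(α(Y)) - Y(α(X)) - α([X, Y])` for `1`-forms. -/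
def extD {k : ℕ} (η : ∀ x : M, TangentSpace I x [⋀^Fin k]→L[ℝ] ℝ) (x₀ : M) :
    TangentSpace I x₀ [⋀^Fin (k + 1)]→L[ℝ] ℝ :=
  (extDerivWithin (chartForm I η x₀) (Set.range I) (extChartAt I x₀ x₀)).compContinuousLinearMap
    (mfderiv I 𝓘(ℝ, E) (extChartAt I x₀) x₀)

/-- The exterior differential of a `1`-form given as a field of covectors. -/
def dForm (α : ∀ x : M, TangentSpace I x →L[ℝ] ℝ) :
    ∀ x : M, TangentSpace I x [⋀^Fin 2]→L[ℝ] ℝ :=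
  extD I (fun x => ContinuousAlternatingMap.ofSubsingleton ℝ (TangentSpace I x) ℝ (0 : Fin 1) (α x))

/-- The interior product `i(v)η = η(v, ·)` of a vector with a `2`-form at a point. -/
def interior {x : M} (v : TangentSpace I x) (η : TangentSpace I x [⋀^Fin 2]→L[ℝ] ℝ) :
    TangentSpace I x →L[ℝ] ℝ where
  toFun w := η ![v, w]
  map_add' w₁ w₂ := by
    have e : ∀ w, ![v, w] = Function.update ![v, 0] 1 w := fun w => by
      funext i; fin_cases i <;> rfl
    rw [e (w₁ + w₂), η.map_update_add, ← e, ← e]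
  map_smul' c w := by
    have e : ∀ w, ![v, w] = Function.update ![v, 0] 1 w := fun w => by
      funext i; fin_cases i <;> rfl
    rw [e (c • w), η.map_update_smul, ← e]
    rfl
  cont := by
    refine η.cont.comp (continuous_pi fun i => ?_)
    fin_cases i
    · exact continuous_const
    · exact continuous_id

/-- The Lie derivative of a `1`-form along a vector field, `L_X α = d(α(X)) + i(X) dα`. -/
def lieForm (X : ∀ x : M, TangentSpace I x) (α : ∀ x : M, TangentSpace I x →L[ℝ] ℝ) (x : M) :
    TangentSpace I x →L[ℝ] ℝ :=
  dFun I (fun y => α y (X y)) x + interior I (X x) (dForm I α x)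

variable [IsManifold I ∞ M]

/-- Smoothness of a vector field. -/
def SmoothVec (X : ∀ x : M, TangentSpace I x) : Prop :=
  ContMDiff I I.tangent ∞ (fun x => (⟨x, X x⟩ : TangentBundle I M))

/-- Smoothness of a `1`-form, as a section of the bundle `Hom(TM, ℝ)`. -/
def SmoothForm (α : ∀ x : M, TangentSpace I x →L[ℝ] ℝ) : Prop :=
  ContMDiff I (I.prod 𝓘(ℝ, E →L[ℝ] ℝ)) ∞
    (fun x => Bundle.TotalSpace.mk' (E →L[ℝ] ℝ)
      (E := fun x : M => TangentSpace I x →L[ℝ] Bundle.Trivial M ℝ x) x (α x))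

/-- Smoothness of a field of endomorphisms of `TM`, as a section of the bundle `Hom(TM, TM)`. -/
def SmoothEnd (F : ∀ x : M, TangentSpace I x →L[ℝ] TangentSpace I x) : Prop :=
  ContMDiff I (I.prod 𝓘(ℝ, E →L[ℝ] E)) ∞
    (fun x => Bundle.TotalSpace.mk' (E →L[ℝ] E)
      (E := fun x : M => TangentSpace I x →L[ℝ] TangentSpace I x) x (F x))

end Fields

section Big

/-! ### The big tangent bundle and generalized structures -/

variable {E : Type*} [NormedAddCommGroup E] [NormedSpace ℝ E]
  {H : Type*} [TopologicalSpace H] (I : ModelWithCorners ℝ E H)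
  {M : Type*} [TopologicalSpace M] [ChartedSpace H M]

/-- The fiber at `x` of the big tangent bundle `TM ⊕ T*M`. -/
abbrev BigT (x : M) : Type _ := TangentSpace I x × (TangentSpace I x →L[ℝ] ℝ)

/-- The neutral metric `g((X, α), (Y, β)) = (α(Y) + β(X)) / 2`. -/
def neutral {x : M} (u v : BigT I x) : ℝ := (1 / 2) * (u.2 v.1 + v.2 u.1)

/-- The Courant bracket
`[(X, α), (Y, β)] = ([X, Y], L_X β - L_Y α + (1/2) d(α(Y) - β(X)))`. -/
def courant (s t : ∀ x : M, BigT I x) (x : M) : BigT I x :=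
  (VectorField.mlieBracket I (fun y => (s y).1) (fun y => (t y).1) x,
    lieForm I (fun y => (s y).1) (fun y => (t y).2) x
      - lieForm I (fun y => (t y).1) (fun y => (s y).2) x
      + (1 / 2 : ℝ) • dFun I (fun y => (s y).2 (t y).1 - (t y).2 (s y).1) x)

/-- The endomorphism of `TM ⊕ T*M` at `x` with matrix `(A, ♯_π; ♭_σ, -ᵗA)`, that is
`(X, α) ↦ (A X + ♯_π α, ♭_σ X - α ∘ A)`. -/
def bigMatrix {x : M} (A : TangentSpace I x →L[ℝ] TangentSpace I x)
    (P : (TangentSpace I x →L[ℝ] ℝ) →L[ℝ] TangentSpace I x)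
    (S : TangentSpace I x →L[ℝ] (TangentSpace I x →L[ℝ] ℝ)) : BigT I x →L[ℝ] BigT I x :=
  (A.coprod P).prod (S.coprod (-(ContinuousLinearMap.precomp ℝ A)))

/-- `♯_{U ∧ V} : α ↦ i(α)(U ∧ V) = α(U) V - α(V) U`. -/
def sharpWedge {x : M} (U V : TangentSpace I x) :
    (TangentSpace I x →L[ℝ] ℝ) →L[ℝ] TangentSpace I x where
  toFun α := α U • V - α V • U
  map_add' α β := by
    simp only [add_apply, add_smul]
    abel
  map_smul' c α := by
    simp only [smul_apply, smul_eq_mul, mul_smul, smul_sub, RingHom.id_apply]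
  cont := by
    fun_prop

/-- `♭_{α ∧ β} : X ↦ i(X)(α ∧ β) = α(X) β - β(X) α`. -/
def flatWedge {x : M} (α β : TangentSpace I x →L[ℝ] ℝ) :
    TangentSpace I x →L[ℝ] (TangentSpace I x →L[ℝ] ℝ) :=
  α.smulRight β - β.smulRight α

/-- For a Riemannian metric `Γ` (so that `♭_Γ : X ↦ Γ(X, ·)` is invertible) the endomorphism
`♯_G : (X, α) ↦ (♯_Γ α, ♭_Γ X)`, `♯_Γ = ♭_Γ⁻¹`, of `TM ⊕ T*M`. It defines the generalized
Riemannian metric `G((X, α), (Y, β)) = Γ(X, Y) + Γ(♯_Γ α, ♯_Γ β)` which corresponds to `Γ`. -/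
def sharpOfMetric (Γ : ∀ x : M, TangentSpace I x →L[ℝ] TangentSpace I x →L[ℝ] ℝ) (x : M) :
    BigT I x →L[ℝ] BigT I x :=
  ((Γ x).inverse.comp (ContinuousLinearMap.snd ℝ _ _)).prod
    ((Γ x).comp (ContinuousLinearMap.fst ℝ _ _))

variable [IsManifold I ∞ M]

/-- Smooth (global) sections of `TM ⊕ T*M`. -/
def SmoothSection (s : ∀ x : M, BigT I x) : Prop :=
  SmoothVec I (fun x => (s x).1) ∧ SmoothForm I (fun x => (s x).2)

/-- Smoothness of a field of endomorphisms of `TM ⊕ T*M`: smooth sections go to smooth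
sections. -/
def SmoothBigEnd (Φ : ∀ x : M, BigT I x →L[ℝ] BigT I x) : Prop :=
  ∀ s : ∀ x : M, BigT I x, SmoothSection I s → SmoothSection I (fun x => Φ x (s x))

/-- `Φ` is a generalized almost complex structure: a smooth, `g`-skew-symmetric endomorphism of
`TM ⊕ T*M` with `Φ² = -Id`. -/
structure IsGenAlmostComplex (Φ : ∀ x : M, BigT I x →L[ℝ] BigT I x) : Prop where
  smooth : SmoothBigEnd I Φ
  skew : ∀ (x : M) (u v : BigT I x), neutral I (Φ x u) v + neutral I u (Φ x v) = 0
  sq : ∀ (x : M) (u : BigT I x), Φ x (Φ x u) = -u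

/-- `u + √-1 v` (`u`, `v` real vectors of `TM ⊕ T*M` at `x`) is in the `√-1`-eigenspace of `Φ`
in the complexification of `TM ⊕ T*M`. -/
def InEigenspace (Φ : ∀ x : M, BigT I x →L[ℝ] BigT I x) (x : M) (u v : BigT I x) : Prop :=
  Φ x u = -v ∧ Φ x v = u

/-- Integrability: the smooth sections of the `√-1`-eigenbundle of `Φ` are closed under the
(complex bilinear extension of the) Courant bracket, where
`[u + √-1 v, u' + √-1 v'] = ([u, u'] - [v, v']) + √-1 ([u, v'] + [v, u'])`. -/
def IsIntegrable (Φ : ∀ x : M, BigT I x →L[ℝ] BigT I x) : Prop :=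
  ∀ u v u' v' : ∀ x : M, BigT I x, SmoothSection I u → SmoothSection I v →
    SmoothSection I u' → SmoothSection I v' →
    (∀ x, InEigenspace I Φ x (u x) (v x)) → (∀ x, InEigenspace I Φ x (u' x) (v' x)) →
    ∀ x, InEigenspace I Φ x (courant I u u' x - courant I v v' x)
      (courant I u v' x + courant I v u' x)

/-- `S = ♯_G` for a generalized Riemannian metric `G(u, v) = 2 g(S u, v)`: `S` is smooth,
`S² = Id`, `S` is a `g`-isometry (so that `G` is symmetric), and `G` is positive definite. -/
structure IsGenRiemannianMetric (S : ∀ x : M, BigT I x →L[ℝ] BigT I x) : Prop where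
  smooth : SmoothBigEnd I S
  sq : ∀ (x : M) (u : BigT I x), S x (S x u) = u
  isometry : ∀ (x : M) (u v : BigT I x), neutral I (S x u) (S x v) = neutral I u v
  pos : ∀ (x : M) (u : BigT I x), u ≠ 0 → 0 < 2 * neutral I (S x u) u

/-- `(G, Φ)`, `S = ♯_G`, is a generalized Kähler structure: `Φ` is a generalized almost complex
structure, `G` is a generalized Riemannian metric, `Φ` is `G`-skew-symmetric, and `Φ` and the
complementary structure `♯_G ∘ Φ` are both integrable. -/
structure IsGenKahler (S Φ : ∀ x : M, BigT I x →L[ℝ] BigT I x) : Prop where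
  almostComplex : IsGenAlmostComplex I Φ
  metric : IsGenRiemannianMetric I S
  skew : ∀ (x : M) (u v : BigT I x),
    2 * neutral I (S x (Φ x u)) v + 2 * neutral I (S x u) (Φ x v) = 0
  integrable : IsIntegrable I Φ
  integrable_compl : IsIntegrable I (fun x => (S x).comp (Φ x))

end Big

section AlmostContact

/-! ### Almost contact metric structures -/

variable {E : Type*} [NormedAddCommGroup E] [NormedSpace ℝ E]
  {H : Type*} [TopologicalSpace H] (I : ModelWithCorners ℝ E H)
  (M : Type*) [TopologicalSpace M] [ChartedSpace H M] [IsManifold I ∞ M]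

/-- An almost contact metric structure `(F, Z, ξ, γ)` on `M`. -/
structure AlmostContactMetric where
  F : ∀ x : M, TangentSpace I x →L[ℝ] TangentSpace I x
  Z : ∀ x : M, TangentSpace I x
  ξ : ∀ x : M, TangentSpace I x →L[ℝ] ℝ
  γ : Bundle.ContMDiffRiemannianMetric I ∞ E (fun x : M => TangentSpace I x)
  smooth_F : SmoothEnd I F
  smooth_Z : SmoothVec I Z
  smooth_ξ : SmoothForm I ξ
  ξ_Z : ∀ x, ξ x (Z x) = 1
  F_Z : ∀ x, F x (Z x) = 0
  ξ_F : ∀ x v, ξ x (F x v) = 0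
  F_F : ∀ x v, F x (F x v) = -v + ξ x v • Z x
  compat : ∀ x v w, γ.inner x (F x v) (F x w) = γ.inner x v w - ξ x v * ξ x w

variable {I M}

namespace AlmostContactMetric

variable (C : AlmostContactMetric I M)

theorem inner_F_self (x : M) (v : TangentSpace I x) : C.γ.inner x (C.F x v) v = 0 := by
  have hZ : ∀ w, C.γ.inner x w (C.Z x) = C.ξ x w := fun w => by
    have h := C.compat x w (C.Z x)
    rw [C.F_Z, C.ξ_Z, map_zero] at h
    linarith
  have h := C.compat x (C.F x v) v
  rw [C.F_F, C.ξ_F, map_add, map_neg, map_smul] at h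
  simp only [add_apply, neg_apply, smul_apply, smul_eq_mul] at h
  rw [C.γ.symm x (C.Z x), hZ, C.ξ_F, C.γ.symm x v] at h
  linarith

/-- The fundamental `2`-form `Ξ(X, Y) = γ(F X, Y)`. -/
def fundamentalForm (x : M) : TangentSpace I x [⋀^Fin 2]→L[ℝ] ℝ where
  toFun v := C.γ.inner x (C.F x (v 0)) (v 1)
  map_update_add' v i a b := by
    fin_cases i <;> simp
  map_update_smul' v i c a := by
    fin_cases i <;> simp
  cont := by
    let G : E →L[ℝ] E →L[ℝ] ℝ := (C.γ.inner x).comp (C.F x)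
    have h : Continuous fun v : Fin 2 → E => G (v 0) (v 1) := by fun_prop
    exact h
  map_eq_zero_of_eq' v i j hv hij := by
    have h01 : v 0 = v 1 := by
      fin_cases i <;> fin_cases j <;> simp_all
    show C.γ.inner x (C.F x (v 0)) (v 1) = 0
    rw [← h01]
    exact C.inner_F_self x (v 0)

/-- Normality: the Nijenhuis tensor
`N_F(X, Y) = [F X, F Y] - F [F X, Y] - F [X, F Y] + F² [X, Y]` equals `-dξ(X, Y) Z`. -/
def IsNormal : Prop :=
  ∀ X Y : ∀ x : M, TangentSpace I x, SmoothVec I X → SmoothVec I Y → ∀ x : M,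
    VectorField.mlieBracket I (fun y => C.F y (X y)) (fun y => C.F y (Y y)) x
      - C.F x (VectorField.mlieBracket I (fun y => C.F y (X y)) Y x)
      - C.F x (VectorField.mlieBracket I X (fun y => C.F y (Y y)) x)
      + C.F x (C.F x (VectorField.mlieBracket I X Y x))
    = -(dForm I C.ξ x ![X x, Y x]) • C.Z x

/-- Cosymplectic in the sense of Blair: normal, with `dξ = 0` and `dΞ = 0`. -/
structure IsCosymplectic : Prop where
  normal : C.IsNormal
  dξ_eq_zero : ∀ x, dForm I C.ξ x = 0
  dΞ_eq_zero : ∀ x, extD I C.fundamentalForm x = 0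

/-! #### The associated objects on `M × ℝ`

At a point `p = (x, t)` of `M × ℝ`, `T_p(M × ℝ) = T_x M × ℝ`, as in Mathlib. -/

/-- The field `∂/∂t` of `M × ℝ`. -/
def ddt (p : M × ℝ) : TangentSpace (I.prod 𝓘(ℝ, ℝ)) p :=
  ((0 : TangentSpace I p.1), (1 : ℝ))

/-- The `1`-form `dt` of `M × ℝ`. -/
def dt (p : M × ℝ) : TangentSpace (I.prod 𝓘(ℝ, ℝ)) p →L[ℝ] ℝ :=
  ContinuousLinearMap.snd ℝ (TangentSpace I p.1) (TangentSpace 𝓘(ℝ, ℝ) p.2)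

/-- The differential `T_p(M × ℝ) → T_x M` of the projection of `M × ℝ` onto `M`. -/
def prM (p : M × ℝ) : TangentSpace (I.prod 𝓘(ℝ, ℝ)) p →L[ℝ] TangentSpace I p.1 :=
  ContinuousLinearMap.fst ℝ (TangentSpace I p.1) (TangentSpace 𝓘(ℝ, ℝ) p.2)

/-- The inclusion `T_x M → T_p(M × ℝ)`. -/
def inM (p : M × ℝ) : TangentSpace I p.1 →L[ℝ] TangentSpace (I.prod 𝓘(ℝ, ℝ)) p :=
  ContinuousLinearMap.inl ℝ (TangentSpace I p.1) (TangentSpace 𝓘(ℝ, ℝ) p.2)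

/-- The metric `γ + dt²` of `M × ℝ`. -/
def prodMetric (p : M × ℝ) : TangentSpace (I.prod 𝓘(ℝ, ℝ)) p →L[ℝ]
    TangentSpace (I.prod 𝓘(ℝ, ℝ)) p →L[ℝ] ℝ :=
  (ContinuousLinearMap.precomp ℝ (prM p)).comp ((C.γ.inner p.1).comp (prM p))
    + (dt (I := I) p).smulRight (dt p)

/-- The generalized almost complex structure `Φ₀` of `M × ℝ`, with the classical tensor fields
`A' = F`, `π' = Z ∧ ∂/∂t`, `σ' = ξ ∧ dt`. -/
def Phi0 (p : M × ℝ) :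
    BigT (I.prod 𝓘(ℝ, ℝ)) p →L[ℝ] BigT (I.prod 𝓘(ℝ, ℝ)) p :=
  bigMatrix (I.prod 𝓘(ℝ, ℝ)) ((inM p).comp ((C.F p.1).comp (prM p)))
    (sharpWedge (I.prod 𝓘(ℝ, ℝ)) (inM p (C.Z p.1)) (ddt p))
    (flatWedge (I.prod 𝓘(ℝ, ℝ)) ((C.ξ p.1).comp (prM p)) (dt p))

end AlmostContactMetric

end AlmostContact

end GenGeom

end

open scoped Topology

noncomputable section

/-! Let ∇ be the Levi-Civita connection of γ + dt², extended to the big tangent bundle. The neutral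
metric and S = ♯_G are both parallel for it, since G comes from a metric alone. As ∇ has no torsion,
the Courant bracket may be written with ∇ in place of partial derivatives. Integrability of Φ then
becomes the vanishing of a tensor linear in ∇Φ (`isIntegrable_iff_obstruction`).

The eigenbundles V₊, V₋ of S are the graphs of plus and minus the metric. They are orthogonal for
the neutral metric, each projects onto the tangent bundle, and Φ and ∇Φ preserve them. On a, b in
V_ε and w in V_{-ε}, the obstruction for Φ reduces to g(∇_wΦ a, Φb) + g(∇_{Φw}Φ a, b), derivatives
being taken along the vector parts. For SΦ the relative sign is reversed, so both terms vanish, and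
nondegeneracy gives ∇Φ = 0 (`parallel_of_obstruction_eq_zero`). The converse is immediate: for a
parallel S, generalized Kähler means Φ parallel (`isGenKahler_iff_parallel`).

Now Φ₀ is linear in (F, Z, ξ), while ∂/∂t and dt are parallel. Hence ∇Φ₀ is the same expression in
(∇F, ∇Z, ∇ξ) and vanishes exactly when these three do (`nablaBig_phiModel`, `phiModel_eq_zero_iff`).
What remains is Blair's theorem that cosymplectic means parallel; after differentiation it is linear
algebra at one point (`IsContactJet.isBlairJet_iff`).

All computations take place at the center of a chart, where the differential of the chart is the
identity. Only first derivatives occur, so Christoffel symbols are needed at the centers alone. -/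

namespace GenGeom

/-! ### Tensor fields and their smoothness in charts -/

section Charts

variable {E : Type*} [NormedAddCommGroup E] [NormedSpace ℝ E]
  {H : Type*} [TopologicalSpace H] (I : ModelWithCorners ℝ E H)
  {M : Type*} [TopologicalSpace M] [ChartedSpace H M]

/-- The differential of the inverse of the chart around `x₀`, read in the model space. -/
def frame (x₀ : M) (y : E) : E →L[ℝ] E :=
  mfderivWithin 𝓘(ℝ, E) I (extChartAt I x₀).symm (Set.range I) y

/-- The differential of the chart around `x₀`, read in the model space. -/
def coframe (x₀ : M) (y : E) : E →L[ℝ] E :=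
  mfderiv I 𝓘(ℝ, E) (extChartAt I x₀) ((extChartAt I x₀).symm y)

/-- A vector field in the chart around `x₀`. -/
def vecHat (x₀ : M) (X : M → E) (y : E) : E := coframe I x₀ y (X ((extChartAt I x₀).symm y))

/-- A `1`-form in the chart around `x₀`. -/
def formHat (x₀ : M) (α : M → E →L[ℝ] ℝ) (y : E) : E →L[ℝ] ℝ :=
  (α ((extChartAt I x₀).symm y)).comp (frame I x₀ y)

/-- A field of endomorphisms in the chart around `x₀`. -/
def endHat (x₀ : M) (F : M → E →L[ℝ] E) (y : E) : E →L[ℝ] E :=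
  (coframe I x₀ y).comp ((F ((extChartAt I x₀).symm y)).comp (frame I x₀ y))

/-- A field of bilinear forms in the chart around `x₀`. -/
def bilinHat (x₀ : M) (γ : M → E →L[ℝ] E →L[ℝ] ℝ) (y : E) : E →L[ℝ] E →L[ℝ] ℝ :=
  (ContinuousLinearMap.precomp ℝ (frame I x₀ y)).comp
    ((γ ((extChartAt I x₀).symm y)).comp (frame I x₀ y))

variable [IsManifold I ∞ M]

theorem isManifold_one : IsManifold I 1 M := IsManifold.of_le (n := ∞) (by simp)

theorem coframe_frame {x₀ : M} {y : E} (hy : y ∈ (extChartAt I x₀).target) (v : E) :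
    coframe I x₀ y (frame I x₀ y v) = v := by
  have : IsManifold I 1 M := isManifold_one I
  exact DFunLike.congr_fun (mfderiv_extChartAt_comp_mfderivWithin_extChartAt_symm (I := I) hy) v

theorem frame_coframe {x₀ : M} {y : E} (hy : y ∈ (extChartAt I x₀).target) (v : E) :
    frame I x₀ y (coframe I x₀ y v) = v := by
  have : IsManifold I 1 M := isManifold_one I
  exact DFunLike.congr_fun (mfderivWithin_extChartAt_symm_comp_mfderiv_extChartAt (I := I) hy) v

/-- The tangent space at `x₀` is the model space read through the preferred chart at `x₀`, so the
map in question is the coordinate change from that chart to itself. This is what makes centers of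
charts convenient. -/
theorem frame_self (x₀ : M) (v : E) : frame I x₀ (extChartAt I x₀ x₀) v = v := by
  have : IsManifold I 1 M := isManifold_one I
  have h := TangentBundle.symmL_trivializationAt (I := I) (mem_chart_source H x₀)
  have h2 := TangentBundle.symmL_trivializationAt_eq_core (I := I) (mem_chart_source H x₀)
  rw [h] at h2
  refine (DFunLike.congr_fun h2 v).trans ?_
  exact (tangentBundleCore I M).coordChange_self (achart H x₀) x₀ (mem_chart_source H x₀) v

theorem coframe_self (x₀ : M) (v : E) : coframe I x₀ (extChartAt I x₀ x₀) v = v := by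
  conv_lhs => rw [← frame_self I x₀ v]
  exact coframe_frame I (mem_extChartAt_target x₀) v

theorem vecHat_self (x₀ : M) (X : M → E) : vecHat I x₀ X (extChartAt I x₀ x₀) = X x₀ := by
  rw [vecHat, coframe_self, extChartAt_to_inv]

theorem formHat_self (x₀ : M) (α : M → E →L[ℝ] ℝ) :
    formHat I x₀ α (extChartAt I x₀ x₀) = α x₀ := by
  ext v
  rw [formHat, ContinuousLinearMap.comp_apply, frame_self, extChartAt_to_inv]

theorem endHat_self (x₀ : M) (F : M → E →L[ℝ] E) :
    endHat I x₀ F (extChartAt I x₀ x₀) = F x₀ := by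
  ext v
  simp only [endHat, ContinuousLinearMap.comp_apply]
  rw [frame_self, coframe_self, extChartAt_to_inv]

omit [IsManifold I ∞ M] in
theorem bilinHat_apply (x₀ : M) (γ : M → E →L[ℝ] E →L[ℝ] ℝ) (y v w : E) :
    bilinHat I x₀ γ y v w =
      γ ((extChartAt I x₀).symm y) (frame I x₀ y v) (frame I x₀ y w) := rfl

theorem bilinHat_self (x₀ : M) (γ : M → E →L[ℝ] E →L[ℝ] ℝ) :
    bilinHat I x₀ γ (extChartAt I x₀ x₀) = γ x₀ := by
  ext v w
  rw [bilinHat_apply, frame_self, frame_self, extChartAt_to_inv]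

section Boundaryless

variable [I.Boundaryless]

omit [IsManifold I ∞ M] in
theorem eventually_mem_target (x₀ : M) :
    ∀ᶠ y in 𝓝 (extChartAt I x₀ x₀), y ∈ (extChartAt I x₀).target :=
  extChartAt_target_mem_nhds x₀

theorem contMDiffAt_iff_chart {G : Type*} [NormedAddCommGroup G] [NormedSpace ℝ G] {f : M → G}
    {x₀ : M} : ContMDiffAt I 𝓘(ℝ, G) ∞ f x₀ ↔
      ContDiffAt ℝ ∞ (fun y => f ((extChartAt I x₀).symm y)) (extChartAt I x₀ x₀) := by
  rw [← contMDiffWithinAt_univ, contMDiffWithinAt_iff_source_of_mem_source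
    (mem_chart_source H x₀), I.range_eq_univ, Set.preimage_univ, Set.univ_inter,
    contMDiffWithinAt_univ, contMDiffAt_iff_contDiffAt]
  rfl

theorem contDiffAt_congr_iff {G : Type*} [NormedAddCommGroup G] [NormedSpace ℝ G] {f g : E → G}
    {y : E} (h : f =ᶠ[𝓝 y] g) : ContDiffAt ℝ ∞ f y ↔ ContDiffAt ℝ ∞ g y :=
  ⟨fun hf => hf.congr_of_eventuallyEq h.symm, fun hg => hg.congr_of_eventuallyEq h⟩

omit [IsManifold I ∞ M] [I.Boundaryless] in
theorem symm_mem_chart_source {x₀ : M} {y : E} (hy : y ∈ (extChartAt I x₀).target) :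
    (extChartAt I x₀).symm y ∈ (chartAt H x₀).source := by
  rw [← extChartAt_source I]
  exact (extChartAt I x₀).map_target hy

omit [I.Boundaryless] in
theorem coframe_eq_trivialization {x₀ : M} {y : E} (hy : y ∈ (extChartAt I x₀).target) :
    have := isManifold_one I (M := M)
    coframe I x₀ y = (trivializationAt E (TangentSpace I) x₀).continuousLinearMapAt ℝ
      ((extChartAt I x₀).symm y) := by
  have := isManifold_one I (M := M)
  exact (TangentBundle.continuousLinearMapAt_trivializationAt (I := I)
    (symm_mem_chart_source I hy)).symm

omit [I.Boundaryless] in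
theorem frame_eq_trivialization {x₀ : M} {y : E} (hy : y ∈ (extChartAt I x₀).target) :
    have := isManifold_one I (M := M)
    frame I x₀ y = (trivializationAt E (TangentSpace I) x₀).symmL ℝ
      ((extChartAt I x₀).symm y) := by
  have := isManifold_one I (M := M)
  refine Eq.symm ((TangentBundle.symmL_trivializationAt (I := I)
    (symm_mem_chart_source I hy)).trans ?_)
  rw [(extChartAt I x₀).right_inv hy]
  rfl

/-- In the trivialization given by the chart around `x₀` the field reads as its chart expression.
Smoothness is a pointwise condition, so each chart is tested only at its own center. -/
theorem smoothVec_iff (X : M → E) : SmoothVec I (M := M) X ↔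
    ∀ x₀ : M, ContDiffAt ℝ ∞ (vecHat I x₀ X) (extChartAt I x₀ x₀) := by
  have : IsManifold I 1 M := isManifold_one I
  refine forall_congr' fun x₀ => ?_
  refine (Bundle.contMDiffAt_section (F := E) (E := fun x : M => TangentSpace I x) x₀).trans ?_
  rw [contMDiffAt_iff_chart]
  refine contDiffAt_congr_iff ?_
  filter_upwards [eventually_mem_target I x₀] with y hy
  rw [vecHat, coframe_eq_trivialization I hy]
  refine Eq.symm ?_
  refine (congrFun ((trivializationAt E (TangentSpace I) x₀).continuousLinearMapAt_apply ℝ _)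
    _).trans ?_
  exact congrFun (Bundle.Trivialization.coe_linearMapAt_of_mem _ (symm_mem_chart_source I hy)) _

theorem smoothForm_iff (α : M → E →L[ℝ] ℝ) : SmoothForm I (M := M) α ↔
    ∀ x₀ : M, ContDiffAt ℝ ∞ (formHat I x₀ α) (extChartAt I x₀ x₀) := by
  have : IsManifold I 1 M := isManifold_one I
  refine forall_congr' fun x₀ => ?_
  refine (Bundle.contMDiffAt_section (F := E →L[ℝ] ℝ)
    (E := fun x : M => TangentSpace I x →L[ℝ] Bundle.Trivial M ℝ x) x₀).trans ?_
  rw [contMDiffAt_iff_chart]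
  refine contDiffAt_congr_iff ?_
  filter_upwards [eventually_mem_target I x₀] with y hy
  rw [formHat, frame_eq_trivialization I hy]
  rw [hom_trivializationAt_apply]
  refine Eq.trans ?_ (ContinuousLinearMap.id_comp _)
  refine congrArg₂ ContinuousLinearMap.comp
    (Bundle.Trivial.continuousLinearMapAt_trivialization ℝ M ℝ _) rfl

theorem SmoothEnd.contDiffAt_hat {F : M → E →L[ℝ] E} (hF : SmoothEnd I (M := M) F) (x₀ : M) :
    ContDiffAt ℝ ∞ (endHat I x₀ F) (extChartAt I x₀ x₀) := by
  have : IsManifold I 1 M := isManifold_one I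
  have h := (Bundle.contMDiffAt_section (F := E →L[ℝ] E)
    (E := fun x : M => TangentSpace I x →L[ℝ] TangentSpace I x) x₀).1 (hF x₀)
  rw [contMDiffAt_iff_chart] at h
  refine h.congr_of_eventuallyEq ?_
  filter_upwards [eventually_mem_target I x₀] with y hy
  rw [endHat, frame_eq_trivialization I hy, coframe_eq_trivialization I hy]
  rw [hom_trivializationAt_apply]
  rfl

theorem contDiffAt_bilinHat {g : M → E →L[ℝ] E →L[ℝ] ℝ}
    (hg : ContMDiff I (I.prod 𝓘(ℝ, E →L[ℝ] E →L[ℝ] ℝ)) ∞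
      (fun x => Bundle.TotalSpace.mk' (E →L[ℝ] E →L[ℝ] ℝ)
        (E := fun x : M => TangentSpace I x →L[ℝ] TangentSpace I x →L[ℝ] ℝ) x (g x))) (x₀ : M) :
    ContDiffAt ℝ ∞ (bilinHat I x₀ g) (extChartAt I x₀ x₀) := by
  have : IsManifold I 1 M := isManifold_one I
  have h := (Bundle.contMDiffAt_section (F := E →L[ℝ] E →L[ℝ] ℝ)
    (E := fun x : M => TangentSpace I x →L[ℝ] TangentSpace I x →L[ℝ] ℝ) x₀).1 (hg x₀)
  rw [contMDiffAt_iff_chart] at h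
  refine h.congr_of_eventuallyEq ?_
  filter_upwards [eventually_mem_target I x₀] with y hy
  ext v w
  rw [bilinHat_apply, frame_eq_trivialization I hy]
  rw [hom_trivializationAt_apply]
  have hs := symm_mem_chart_source I hy
  refine Eq.symm ?_
  refine (inCoordinates_apply_eq₂ (F₁ := E) (F₂ := E) (F₃ := ℝ)
    (E₁ := fun x : M => TangentSpace I x) (E₂ := fun x : M => TangentSpace I x)
    (E₃ := Bundle.Trivial M ℝ) hs hs (Set.mem_univ _)).trans ?_
  refine (DFunLike.congr_fun (Bundle.Trivial.linearMapAt_trivialization ℝ M ℝ _) _).trans ?_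
  have e : ∀ v : E, (trivializationAt E (TangentSpace I) x₀).symmL ℝ ((extChartAt I x₀).symm y) v
      = (trivializationAt E (TangentSpace I) x₀).symm ((extChartAt I x₀).symm y) v :=
    fun v => Bundle.Trivialization.symmL_apply _ hs v
  exact (congrArg₂ (fun a b => g ((extChartAt I x₀).symm y) a b) (e v) (e w)).symm

end Boundaryless

/-! ### Global sections with a prescribed value -/

section Extension

variable [FiniteDimensional ℝ E] [T2Space M]

/-- Every vector of a smooth vector bundle over a Hausdorff manifold is the value of a global
smooth section. -/
theorem exists_contMDiff_section_eq {V : Type*} [NormedAddCommGroup V] [NormedSpace ℝ V]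
    (W : M → Type*) [TopologicalSpace (Bundle.TotalSpace V W)] [∀ x, AddCommGroup (W x)]
    [∀ x, Module ℝ (W x)] [∀ x, TopologicalSpace (W x)] [FiberBundle V W] [VectorBundle ℝ V W]
    [ContMDiffVectorBundle ∞ V W I] (x₀ : M) (v : W x₀) :
    ∃ s : ∀ x, W x, ContMDiff I (I.prod 𝓘(ℝ, V)) ∞ (fun x => Bundle.TotalSpace.mk' V x (s x)) ∧
      s x₀ = v := by
  obtain ⟨u, hu, hs⟩ := FiberBundle.exists_contMDiffOn_extend I V (k := ∞) v
  obtain ⟨u', hu', ho, hx⟩ := mem_nhds_iff.1 hu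
  -- The local extension is cut off by a bump function supported where it is smooth and equal to 1
  -- at `x₀`.
  obtain ⟨f, hf⟩ := (SmoothBumpFunction.nhds_basis_tsupport (I := I) x₀).mem_iff.1 (ho.mem_nhds hx)
  refine ⟨(f : M → ℝ) • FiberBundle.extend V v,
    ContMDiffOn.smul_section_of_tsupport f.contMDiff.contMDiffOn ho hf.2 (hs.mono hu'), ?_⟩
  rw [Pi.smul_apply', FiberBundle.extend_apply_self, f.eq_one, one_smul]

theorem exists_smoothVec_eq (x₀ : M) (v : E) : ∃ X : M → E, SmoothVec I (M := M) X ∧ X x₀ = v := by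
  have : IsManifold I (∞ + 1) M := by simpa
  exact exists_contMDiff_section_eq I (fun x : M => TangentSpace I x) x₀ v

theorem exists_smoothForm_eq (x₀ : M) (a : E →L[ℝ] ℝ) :
    ∃ α : M → E →L[ℝ] ℝ, SmoothForm I (M := M) α ∧ α x₀ = a := by
  have : IsManifold I 1 M := isManifold_one I
  have : IsManifold I (∞ + 1) M := by simpa
  exact exists_contMDiff_section_eq I
    (fun x : M => TangentSpace I x →L[ℝ] Bundle.Trivial M ℝ x) x₀ a

end Extension
end Charts

/-! ### First-order data of sections and forms on a vector space -/

section Jets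

variable {V : Type*} [NormedAddCommGroup V] [NormedSpace ℝ V]

/-- The fiber of the big tangent bundle of a vector space. -/
abbrev Big (V : Type*) [NormedAddCommGroup V] [NormedSpace ℝ V] : Type _ := V × (V →L[ℝ] ℝ)

/-- The neutral pairing. -/
def pair (u v : Big V) : ℝ := (1 / 2) * (u.2 v.1 + v.2 u.1)

/-- The `1`-form `w ↦ g(∂_w u, u')`, where `du` is the differential of `u`. -/
def pairDiff (du : V →L[ℝ] Big V) (u' : Big V) : V →L[ℝ] ℝ :=
  (1 / 2 : ℝ) • ((u'.2).comp ((ContinuousLinearMap.fst ℝ _ _).comp du)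
    + (ContinuousLinearMap.apply ℝ ℝ u'.1).comp ((ContinuousLinearMap.snd ℝ _ _).comp du))

theorem pairDiff_apply (du : V →L[ℝ] Big V) (u' : Big V) (w : V) :
    pairDiff du u' w = pair (du w) u' := by
  simp [pairDiff, pair]
  ring

/-- The Courant bracket of two sections with given values `u, u'` and differentials `du, du'` at a
point of a vector space. -/
def courJet (u : Big V) (du : V →L[ℝ] Big V) (u' : Big V) (du' : V →L[ℝ] Big V) : Big V :=
  ((du' u.1).1 - (du u'.1).1,
    (du' u.1).2 - (du u'.1).2 + pairDiff du u' - pairDiff du' u)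

/-- A linear form as an alternating `1`-form. -/
def altOfLin : (V →L[ℝ] ℝ) →L[ℝ] (V [⋀^Fin 1]→L[ℝ] ℝ) :=
  (ContinuousAlternatingMap.ofSubsingletonLIE (𝕜 := ℝ) (E := V) (F := ℝ)
    (0 : Fin 1)).toContinuousLinearEquiv

/-- The `2`-form of a skew-symmetric bilinear form. -/
def altOfBilin (b : V →L[ℝ] V →L[ℝ] ℝ) : V [⋀^Fin 2]→L[ℝ] ℝ :=
  -- Alternatization produces b(v, w) - b(w, v), which is twice b for a skew form.
  (1 / 2 : ℝ) • ContinuousAlternatingMap.alternatizeUncurryFin (altOfLin.comp b)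

theorem hasFDerivAt_altOfBilin {b : V → V →L[ℝ] V →L[ℝ] ℝ} {db : V →L[ℝ] V →L[ℝ] V →L[ℝ] ℝ}
    {y : V} (hb : HasFDerivAt b db y) :
    ∃ D : V →L[ℝ] V [⋀^Fin 2]→L[ℝ] ℝ, HasFDerivAt (fun z => altOfBilin (b z)) D y ∧
      ∀ u, D u = altOfBilin (db u) := by
  have h1 := (hasFDerivAt_const (altOfLin (V := V)) y).clm_comp hb
  have h2 := ((ContinuousAlternatingMap.alternatizeUncurryFinCLM ℝ V ℝ).hasFDerivAt.comp y
    h1).const_smul (1 / 2 : ℝ)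
  refine ⟨_, h2, fun u => ?_⟩
  simp [altOfBilin]

theorem altOfBilin_apply (b : V →L[ℝ] V →L[ℝ] ℝ) (v : Fin 2 → V) :
    altOfBilin b v = (1 / 2) * (b (v 0) (v 1) - b (v 1) (v 0)) := by
  simp [altOfBilin, altOfLin, ContinuousAlternatingMap.alternatizeUncurryFin_apply,
    Fin.sum_univ_two, Fin.removeNth]
  ring

end Jets

/-! ### Lie bracket, exterior differential and Courant bracket at the center of a chart -/

section Charts

variable {E : Type*} [NormedAddCommGroup E] [NormedSpace ℝ E]
  {H : Type*} [TopologicalSpace H] (I : ModelWithCorners ℝ E H)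
  {M : Type*} [TopologicalSpace M] [ChartedSpace H M]

/-- A section of the big tangent bundle in the chart around `x₀`. -/
def secHat (x₀ : M) (s : M → Big E) (y : E) : Big E :=
  (vecHat I x₀ (fun x => (s x).1) y, formHat I x₀ (fun x => (s x).2) y)

variable [IsManifold I ∞ M] [I.Boundaryless]

omit [I.Boundaryless] in
theorem secHat_self (x₀ : M) (s : M → Big E) : secHat I x₀ s (extChartAt I x₀ x₀) = s x₀ := by
  rw [secHat, vecHat_self, formHat_self]

/-- The pullback uses the inverse of the frame, which on the chart target is the coframe. This links
the library's bracket to the chart expressions. -/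
theorem mpullbackWithin_eventuallyEq_vecHat (x₀ : M) (X : M → E) :
    VectorField.mpullbackWithin 𝓘(ℝ, E) I (extChartAt I x₀).symm X (Set.range I)
      =ᶠ[𝓝 (extChartAt I x₀ x₀)] vecHat I x₀ X := by
  filter_upwards [eventually_mem_target I x₀] with y hy
  have h : (frame I x₀ y).inverse = coframe I x₀ y :=
    ContinuousLinearMap.inverse_eq (ContinuousLinearMap.ext (frame_coframe I hy))
      (ContinuousLinearMap.ext (coframe_frame I hy))
  exact DFunLike.congr_fun h _

omit [I.Boundaryless] in
theorem mfderiv_extChartAt_self (x₀ : M) :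
    (mfderiv I 𝓘(ℝ, E) (extChartAt I x₀) x₀ : E →L[ℝ] E) = ContinuousLinearMap.id ℝ E := by
  refine ContinuousLinearMap.ext fun v => ?_
  refine Eq.trans ?_ (coframe_self I x₀ v)
  rw [coframe]
  exact congrArg (fun z => (mfderiv I 𝓘(ℝ, E) (extChartAt I x₀) z : E →L[ℝ] E) v)
      (extChartAt_to_inv (I := I) x₀).symm

theorem lieBracketWithin_eq_of_eventuallyEq {V W V' W' : E → E} {s : Set E} {y : E}
    {dV dW : E →L[ℝ] E} (hs : s = Set.univ) (hV : V =ᶠ[𝓝 y] V') (hW : W =ᶠ[𝓝 y] W')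
    (hV' : HasFDerivAt V' dV y) (hW' : HasFDerivAt W' dW y) :
    VectorField.lieBracketWithin ℝ V W s y = dW (V' y) - dV (W' y) := by
  rw [hs, VectorField.lieBracketWithin_univ, hV.lieBracket_vectorField_eq hW,
    VectorField.lieBracket, hV'.fderiv, hW'.fderiv]

theorem inverse_apply_of_eq_id {A : E →L[ℝ] E} (h : A = ContinuousLinearMap.id ℝ E) (v : E) :
    A.inverse v = v := by
  rw [h, ContinuousLinearMap.inverse_id, ContinuousLinearMap.id_apply]

theorem mlieBracket_eq_chart {x₀ : M} {X Y : M → E} {dX dY : E →L[ℝ] E}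
    (hX : HasFDerivAt (vecHat I x₀ X) dX (extChartAt I x₀ x₀))
    (hY : HasFDerivAt (vecHat I x₀ Y) dY (extChartAt I x₀ x₀)) :
    VectorField.mlieBracket (M := M) I X Y x₀ = (dY (X x₀) - dX (Y x₀) : E) := by
  refine (inverse_apply_of_eq_id (E := E) (mfderiv_extChartAt_self I x₀) _).trans ?_
  refine (lieBracketWithin_eq_of_eventuallyEq ?_ (mpullbackWithin_eventuallyEq_vecHat I x₀ X)
    (mpullbackWithin_eventuallyEq_vecHat I x₀ Y) hX hY).trans ?_
  · rw [Set.preimage_univ, Set.univ_inter, I.range_eq_univ]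
  · rw [vecHat_self, vecHat_self]

theorem extD_eq_extDeriv {k : ℕ} (η : M → E [⋀^Fin k]→L[ℝ] ℝ) (x₀ : M) (v : Fin (k + 1) → E) :
    extD (M := M) I η x₀ v = extDeriv (chartForm (M := M) I η x₀) (extChartAt I x₀ x₀) v := by
  have h : ∀ (s : Set E) (_ : s = Set.univ) (η' : E → E [⋀^Fin k]→L[ℝ] ℝ) (L : E →L[ℝ] E)
      (_ : L = ContinuousLinearMap.id ℝ E) (y : E),
      (extDerivWithin η' s y).compContinuousLinearMap L v = extDeriv η' y v := by
    rintro s rfl η' L rfl y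
    rw [extDerivWithin_univ]
    rfl
  exact h _ I.range_eq_univ _ _ (mfderiv_extChartAt_self I x₀) _

theorem dForm_eq_chart {x₀ : M} {α : M → E →L[ℝ] ℝ} {dα : E →L[ℝ] E →L[ℝ] ℝ}
    (hα : HasFDerivAt (formHat I x₀ α) dα (extChartAt I x₀ x₀)) (v w : E) :
    dForm (M := M) I α x₀ ![v, w] = dα v w - dα w v := by
  have h : chartForm (M := M) I (fun x => ContinuousAlternatingMap.ofSubsingleton ℝ E ℝ (0 : Fin 1)
      (α x)) x₀ = fun y => ContinuousAlternatingMap.ofSubsingletonLIE (𝕜 := ℝ) (E := E) (F := ℝ)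
        (0 : Fin 1) (formHat I x₀ α y) := rfl
  refine (extD_eq_extDeriv I (fun x => ContinuousAlternatingMap.ofSubsingleton ℝ E ℝ (0 : Fin 1)
      (α x)) x₀ ![v, w]).trans ?_
  have hd := ((ContinuousAlternatingMap.ofSubsingletonLIE (𝕜 := ℝ) (E := E) (F := ℝ)
        (0 : Fin 1)).toContinuousLinearEquiv.hasFDerivAt).comp _ hα
  rw [h, extDeriv]
  erw [HasFDerivAt.fderiv hd]
  rw [ContinuousAlternatingMap.alternatizeUncurryFin_apply, Fin.sum_univ_two]
  change (-1) ^ 0 • dα v w + (-1) ^ 1 • dα w v = _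
  simp [sub_eq_add_neg]

/-- The chart expression is `altOfBilin` of the coefficient matrix, and `altOfBilin` is linear. The
alternating sum over three slots collapses to a cyclic one because the differential of a skew matrix
is skew. -/
theorem extD_two_eq_chart {x₀ : M} {b : M → E →L[ℝ] E →L[ℝ] ℝ} {db : E →L[ℝ] E →L[ℝ] E →L[ℝ] ℝ}
    (hb : HasFDerivAt (bilinHat I x₀ b) db (extChartAt I x₀ x₀)) {η : M → E [⋀^Fin 2]→L[ℝ] ℝ}
    (hη : ∀ x v, η x v = b x (v 0) (v 1)) (hb' : ∀ x v w, b x v w = - b x w v) (u v w : E) :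
    extD (M := M) I η x₀ ![u, v, w] = db u v w + db v w u + db w u v := by
  have h : chartForm (M := M) I η x₀ = fun y => altOfBilin (bilinHat I x₀ b y) := by
    funext y
    ext v
    rw [altOfBilin_apply, bilinHat_apply, bilinHat_apply, hb' _ (frame I x₀ y (v 1))]
    refine (hη _ _).trans ?_
    change b _ (frame I x₀ y (v 0)) (frame I x₀ y (v 1)) = _
    ring
  obtain ⟨D, hd, hD⟩ := hasFDerivAt_altOfBilin hb
  have hskew : ∀ a c d, db a c d = - db a d c := by
    intro a c d
    have h1 : HasFDerivAt (fun y => bilinHat I x₀ b y c d) _ _ :=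
      (hb.clm_apply (hasFDerivAt_const c _)).clm_apply (hasFDerivAt_const d _)
    have h2 : HasFDerivAt (fun y => - bilinHat I x₀ b y d c) _ _ :=
      ((hb.clm_apply (hasFDerivAt_const d _)).clm_apply (hasFDerivAt_const c _)).neg
    have h3 : (fun y => bilinHat I x₀ b y c d) = fun y => - bilinHat I x₀ b y d c :=
      funext fun y => hb' _ _ _
    rw [h3] at h1
    simpa using DFunLike.congr_fun (h1.unique h2) a
  refine (extD_eq_extDeriv I η x₀ ![u, v, w]).trans ?_
  rw [h, extDeriv, HasFDerivAt.fderiv hd, ContinuousAlternatingMap.alternatizeUncurryFin_apply]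
  rw [Fin.sum_univ_three]
  simp only [hD, altOfBilin_apply]
  change (-1) ^ 0 • (1 / 2 * (db u v w - db u w v)) + (-1) ^ 1 • (1 / 2 * (db v u w - db v w u))
    + (-1) ^ 2 • (1 / 2 * (db w u v - db w v u)) = _
  rw [hskew u w v, hskew v u w, hskew w v u]
  simp
  ring

theorem dFun_eq_chart {x₀ : M} {f : M → ℝ} {df : E →L[ℝ] ℝ}
    (hf : HasFDerivAt (fun y => f ((extChartAt I x₀).symm y)) df (extChartAt I x₀ x₀)) :
    dFun I f x₀ = df := by
  have : IsManifold I 1 M := isManifold_one I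
  have hc : MDifferentiableAt I 𝓘(ℝ, ℝ) f x₀ := by
    rw [mdifferentiableAt_iff_source_of_mem_source (mem_chart_source H x₀), I.range_eq_univ,
      mdifferentiableWithinAt_univ, mdifferentiableAt_iff_differentiableAt]
    exact hf.differentiableAt
  refine hc.mfderiv.trans ?_
  rw [I.range_eq_univ, fderivWithin_univ]
  exact hf.fderiv

theorem courant_eq_chart {x₀ : M} {s t : M → Big E} {ds dt : E →L[ℝ] Big E}
    (hs : HasFDerivAt (secHat I x₀ s) ds (extChartAt I x₀ x₀))
    (ht : HasFDerivAt (secHat I x₀ t) dt (extChartAt I x₀ x₀)) :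
    courant (M := M) I s t x₀ = courJet (s x₀) ds (t x₀) dt := by
  have hs1 : HasFDerivAt (vecHat I x₀ fun x => (s x).1) _ _ := hs.fst
  have hs2 : HasFDerivAt (formHat I x₀ fun x => (s x).2) _ _ := hs.snd
  have ht1 : HasFDerivAt (vecHat I x₀ fun x => (t x).1) _ _ := ht.fst
  have ht2 : HasFDerivAt (formHat I x₀ fun x => (t x).2) _ _ := ht.snd
  -- Frame and coframe cancel in α(X), so the product rule applies to the chart expressions.
  have key : ∀ {X : M → E} {α : M → E →L[ℝ] ℝ} {dX : E →L[ℝ] E} {dα : E →L[ℝ] E →L[ℝ] ℝ},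
      HasFDerivAt (vecHat I x₀ X) dX (extChartAt I x₀ x₀) →
      HasFDerivAt (formHat I x₀ α) dα (extChartAt I x₀ x₀) →
      HasFDerivAt (fun y => α ((extChartAt I x₀).symm y) (X ((extChartAt I x₀).symm y)))
        ((α x₀).comp dX + dα.flip (X x₀)) (extChartAt I x₀ x₀) := by
    intro X α dX dα hX hα
    have h := hα.clm_apply hX
    rw [vecHat_self, formHat_self] at h
    refine h.congr_of_eventuallyEq ?_
    filter_upwards [eventually_mem_target I x₀] with y hy
    rw [vecHat, formHat, ContinuousLinearMap.comp_apply, frame_coframe I hy]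
  refine Prod.ext (mlieBracket_eq_chart I hs1 ht1) (ContinuousLinearMap.ext fun (w : E) => ?_)
  have e1 := DFunLike.congr_fun (dFun_eq_chart I (f := fun x => (t x).2 (s x).1) (key hs1 ht2)) w
  have e2 := DFunLike.congr_fun (dFun_eq_chart I (f := fun x => (s x).2 (t x).1) (key ht1 hs2)) w
  have e3 := DFunLike.congr_fun (dFun_eq_chart I (f := fun x => (s x).2 (t x).1 - (t x).2 (s x).1)
    ((key ht1 hs2).sub (key hs1 ht2))) w
  have e4 := dForm_eq_chart I ht2 (s x₀).1 w
  have e5 := dForm_eq_chart I hs2 (t x₀).1 w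
  -- In each Lie derivative the derivative of the form along `w` cancels between d(α(X)) and i(X)dα.
  -- The half differential then turns the rest into neutral pairings of `ds w` with `t` and of `dt
  -- w` with `s`.
  have h : ((t x₀).2 (ds w).1 + (dt w).2 (s x₀).1 + ((dt (s x₀).1).2 w - (dt w).2 (s x₀).1))
      - ((s x₀).2 (dt w).1 + (ds w).2 (t x₀).1 + ((ds (t x₀).1).2 w - (ds w).2 (t x₀).1))
      + (1 / 2 : ℝ) * ((s x₀).2 (dt w).1 + (ds w).2 (t x₀).1
        - ((t x₀).2 (ds w).1 + (dt w).2 (s x₀).1)) = (courJet (s x₀) ds (t x₀) dt).2 w := by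
    simp only [courJet, add_apply, sub_apply, pairDiff_apply, pair]
    ring
  exact (congrArg₂ (· + ·) (congrArg₂ (· - ·) (congrArg₂ (· + ·) e1 e4)
    (congrArg₂ (· + ·) e2 e5)) (congrArg ((1 / 2 : ℝ) * ·) e3)).trans h

end Charts

/-! ### The integrability obstruction, and the pointwise argument for parallelism -/

section BigAlgebra

variable {V : Type*} [NormedAddCommGroup V] [NormedSpace ℝ V]

theorem pair_add_left (a b c : Big V) : pair (a + b) c = pair a c + pair b c := by
  simp [pair]; ring

theorem pair_add_right (a b c : Big V) : pair a (b + c) = pair a b + pair a c := by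
  simp [pair]; ring

theorem pair_neg_left (a b : Big V) : pair (-a) b = -pair a b := by
  simp [pair]; ring

theorem pair_neg_right (a b : Big V) : pair a (-b) = -pair a b := by
  simp [pair]; ring

theorem pair_sub_left (a b c : Big V) : pair (a - b) c = pair a c - pair b c := by
  simp [pair]; ring

theorem pair_sub_right (a b c : Big V) : pair a (b - c) = pair a b - pair a c := by
  simp [pair]; ring

theorem pair_smul_left (r : ℝ) (a b : Big V) : pair (r • a) b = r * pair a b := by
  simp [pair]; ring

theorem pair_smul_right (r : ℝ) (a b : Big V) : pair a (r • b) = r * pair a b := by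
  simp [pair]; ring

theorem pair_comm (a b : Big V) : pair a b = pair b a := by
  simp [pair]; ring

theorem eq_of_forall_pair_eq {a b : Big V} (h : ∀ w, pair a w = pair b w) : a = b := by
  refine Prod.ext ?_ (ContinuousLinearMap.ext fun w => ?_)
  · by_contra hne
    -- Covectors separate vectors by Hahn–Banach, so no finite dimension is needed.
    obtain ⟨f, hf⟩ := exists_dual_vector'' ℝ (a.1 - b.1)
    have h1 := h (0, f)
    simp only [pair, map_zero, zero_add] at h1
    have h2 : f (a.1 - b.1) = 0 := by rw [map_sub]; linarith
    rw [h2] at hf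
    refine hne (sub_eq_zero.1 (norm_eq_zero.1 ?_))
    exact_mod_cast hf.2.symm
  · have := h (w, 0)
    simp only [pair, zero_apply, add_zero] at this
    linarith

/-- The pairing of the Courant bracket of two sections with `w`, in terms of the values `u, u'` and
of the covariant derivatives `n, n'` of the sections, for a torsion-free connection. -/
def courPair (u : Big V) (n : V → Big V) (u' : Big V) (n' : V → Big V) (w : Big V) : ℝ :=
  pair (n' u.1) w - pair (n u'.1) w + (1 / 2) * (pair (n w.1) u' - pair (n' w.1) u)

/-- The action of an endomorphism on `V × V*`, as a derivation of the tensor algebra. -/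
def bigAct (c : V →L[ℝ] V) (u : Big V) : Big V := (c u.1, -u.2.comp c)

/-- The connection terms cancel in pairs by the symmetry of `C`: a torsion-free connection does not
affect the Courant bracket. -/
theorem pair_courJet {C : V →L[ℝ] V →L[ℝ] V} (hC : ∀ v w, C v w = C w v) (u : Big V)
    (du : V →L[ℝ] Big V) (u' : Big V) (du' : V →L[ℝ] Big V) (w : Big V) :
    pair (courJet u du u' du') w =
      courPair u (fun v => du v + bigAct (C v) u) u' (fun v => du' v + bigAct (C v) u') w := by
  have h : pair (courJet u du u' du') w = courPair u du u' du' w := by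
    simp only [courPair, pair, courJet, add_apply, sub_apply, pairDiff_apply, map_sub]
    ring
  rw [h]
  simp only [courPair, pair, bigAct, Prod.fst_add, Prod.snd_add, add_apply, neg_apply, map_add,
    ContinuousLinearMap.comp_apply]
  rw [hC u'.1 u.1, hC w.1 u.1, hC w.1 u'.1]
  ring

/-- The obstruction to integrability of `Φ` with covariant derivative `P`. -/
def obstruction (Φ : Big V → Big V) (P : V → Big V → Big V) (a b w : Big V) : ℝ :=
  pair (P (Φ a).1 b) w - pair (P (Φ b).1 a) w
    + (1 / 2) * (pair (P w.1 a) (Φ b) - pair (P w.1 b) (Φ a))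
    + pair (P a.1 b) (Φ w) - pair (P b.1 a) (Φ w)
    + (1 / 2) * (pair (P (Φ w).1 a) b - pair (P (Φ w).1 b) a)

/-- The left side is the test of `eigen_iff` for the bracket of Φa + √-1 a and Φb + √-1 b. By
skewness and Φ² = -Id the derivatives `na`, `nb` of the sections cancel, so the condition is
tensorial and sees only the derivative `P` of Φ. -/
theorem courPair_eq_obstruction {Φ : Big V →L[ℝ] Big V} (P : V → Big V → Big V)
    (hskew : ∀ a b, pair (Φ a) b = -pair a (Φ b)) (hsq : ∀ a, Φ (Φ a) = -a)
    (a b w : Big V) (na nb : V → Big V) :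
    courPair (Φ a) (fun v => P v a + Φ (na v)) (Φ b) (fun v => P v b + Φ (nb v)) w
      - courPair a na b nb w
      + courPair (Φ a) (fun v => P v a + Φ (na v)) b nb (Φ w)
      + courPair a na (Φ b) (fun v => P v b + Φ (nb v)) (Φ w) = obstruction Φ P a b w := by
  simp only [courPair, obstruction, pair_add_left, hskew (na _), hskew (nb _), hsq, pair_neg_right]
  ring

/-- `ΦL = K` if and only if the pairings with all `w` agree. -/
theorem eigen_iff {Φ : Big V →L[ℝ] Big V} (hskew : ∀ a b, pair (Φ a) b = -pair a (Φ b))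
    (hsq : ∀ a, Φ (Φ a) = -a) (K L : Big V) :
    (Φ K = -L ∧ Φ L = K) ↔ ∀ w, pair K w + pair L (Φ w) = 0 := by
  constructor
  · rintro ⟨-, h⟩ w
    rw [← h, hskew]
    ring
  · intro h
    have hL : Φ L = K := eq_of_forall_pair_eq fun w => by
      have := h w
      rw [hskew]
      linarith
    exact ⟨by rw [← hL, hsq], hL⟩

/-- If the obstructions to the integrability of `Φ` and of `SΦ` vanish, and `S` is parallel, then
`Φ` is parallel. -/
theorem parallel_of_obstruction_eq_zero {Φ S : Big V →L[ℝ] Big V} {P : V → Big V →L[ℝ] Big V}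
    (hskew : ∀ a b, pair (Φ a) b = -pair a (Φ b)) (hsq : ∀ a, Φ (Φ a) = -a)
    (hPneg : ∀ v a, P (-v) a = -P v a)
    (hPskew : ∀ v a b, pair (P v a) b = -pair a (P v b))
    (hPanti : ∀ v a, P v (Φ a) = -Φ (P v a))
    (hS : ∀ a, S (S a) = a) (hSiso : ∀ a b, pair (S a) (S b) = pair a b)
    (hSΦ : ∀ a, S (Φ a) = Φ (S a)) (hSP : ∀ v a, S (P v a) = P v (S a))
    (hsurj : ∀ (ε : ℝ), ε = 1 ∨ ε = -1 → ∀ v : V, ∃ w : Big V, S w = ε • w ∧ w.1 = v)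
    (h1 : ∀ a b w, obstruction Φ (fun v => P v) a b w = 0)
    (h2 : ∀ a b w, obstruction (fun a => S (Φ a)) (fun v a => S (P v a)) a b w = 0)
    (v : V) (a : Big V) : P v a = 0 := by
  -- Opposite eigenspaces of the isometry `S` are orthogonal for the pairing.
  have horth : ∀ (ε : ℝ), ε = 1 ∨ ε = -1 → ∀ a b, S a = ε • a → S b = -ε • b → pair a b = 0 := by
    intro ε hε a b ha hb
    have := hSiso a b
    rw [ha, hb, pair_smul_left, pair_smul_right] at this
    rcases hε with rfl | rfl <;> linarith
  have key : ∀ (ε : ℝ), ε = 1 ∨ ε = -1 → ∀ a b, S a = ε • a → S b = ε • b → ∀ v,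
      pair (P v a) (Φ b) = 0 := by
    intro ε hε a b ha hb v
    have hε' : -ε = 1 ∨ -ε = -1 := by rcases hε with rfl | rfl <;> norm_num
    -- `w` lies in the opposite eigenspace, so pairings of `P a` or `P b` with `w` or Φw vanish, yet
    -- its vector part is an arbitrary direction.
    obtain ⟨w, hw, rfl⟩ := hsurj (-ε) hε' v
    have hΦ : ∀ δ : ℝ, ∀ c, S c = δ • c → S (Φ c) = δ • Φ c := fun δ c hc => by
      rw [hSΦ, hc, map_smul]
    have hP : ∀ δ : ℝ, ∀ v c, S c = δ • c → S (P v c) = δ • P v c := fun δ v c hc => by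
      rw [hSP, hc, map_smul]
    have e1 := h1 a b w
    have e2 := h2 a b w
    simp only [obstruction] at e1 e2
    have z : ∀ v c d, S c = ε • c → S d = -ε • d → pair (P v c) d = 0 := fun v c d hc hd =>
      horth ε hε _ _ (hP _ _ _ hc) hd
    simp only [hΦ ε a ha, hΦ ε b hb, hΦ _ w hw, hP ε _ a ha, hP ε _ b hb, pair_smul_left,
      pair_smul_right, z _ a w ha hw, z _ b w hb hw, z _ a _ ha (hΦ _ w hw),
      z _ b _ hb (hΦ _ w hw)] at e1 e2
    -- Exchanging `a` and `b` only changes signs, so each surviving half-difference is a single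
    -- term.
    have f1 : ∀ v, pair (P v b) (Φ a) = -pair (P v a) (Φ b) := fun v => by
      rw [hPskew, hPanti, pair_neg_right, neg_neg, ← neg_eq_iff_eq_neg.2 (hskew b (P v a)),
        pair_comm]
    have f2 : ∀ v, pair (P v b) a = -pair (P v a) b := fun v => by
      rw [hPskew, pair_comm]
    rw [f1, f2] at e1 e2
    -- Both obstructions contain the term to be killed with the same sign, while the one along Φw
    -- changes sign from Φ to SΦ. Adding them isolates the former. The derivative direction for SΦ
    -- is -εΦw, so oddness of `P` is needed only for ε = 1.
    rcases hε with rfl | rfl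
    · have e : P (-(1 : ℝ) • Φ w).1 a = -P (Φ w).1 a := by
        have e0 : -(1 : ℝ) • Φ w = -Φ w := by module
        rw [e0, Prod.fst_neg, hPneg]
      rw [e, pair_neg_left] at e2
      linarith
    · simp only [one_smul, neg_neg] at e2
      linarith
  have key' : ∀ (ε : ℝ), ε = 1 ∨ ε = -1 → ∀ a, S a = ε • a → ∀ v, P v a = 0 := by
    intro ε hε a ha v
    refine eq_of_forall_pair_eq fun w => ?_
    have hw : w = (1 / 2 : ℝ) • (w + ε • S w) + (1 / 2 : ℝ) • (w - ε • S w) := by module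
    have hεε : ε * ε = 1 := by rcases hε with rfl | rfl <;> norm_num
    have hw1 : S (w + ε • S w) = ε • (w + ε • S w) := by
      rw [map_add, map_smul, hS, smul_add, smul_smul, hεε, one_smul, add_comm]
    have hw2 : S (w - ε • S w) = -ε • (w - ε • S w) := by
      rw [map_sub, map_smul, hS, smul_sub, smul_smul, neg_mul, hεε]
      module
    have hPa : S (P v a) = ε • P v a := by rw [hSP, ha, map_smul]
    have hz : pair (0 : Big V) w = 0 := by simp [pair]
    -- Φ maps the eigenspace onto itself, so `key` is applied to the Φ-image of the projected vector
    -- and Φ² = -Id brings it back.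
    have k1 : pair (P v a) (w + ε • S w) = 0 := by
      have := key ε hε a (Φ (w + ε • S w)) ha (by rw [hSΦ, hw1, map_smul]) v
      rw [hsq, pair_neg_right] at this
      linarith
    rw [hz, hw, pair_add_right, pair_smul_right, pair_smul_right, k1, horth ε hε _ _ hPa hw2]
    ring
  have ha : a = (1 / 2 : ℝ) • (a + S a) + (1 / 2 : ℝ) • (a - S a) := by module
  rw [ha, map_add, map_smul, map_smul, key' 1 (Or.inl rfl) _ (by rw [map_add, hS]; module) v,
    key' (-1) (Or.inr rfl) _ (by rw [map_sub, hS]; module) v, smul_zero, add_zero]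

end BigAlgebra

/-! ### Covariant derivatives of endomorphisms of the big tangent bundle -/

section Parallel

variable {V : Type*} [NormedAddCommGroup V] [NormedSpace ℝ V]

/-- The action of an endomorphism on `V × V*`, as a continuous linear map. -/
def bigActL (c : V →L[ℝ] V) : Big V →L[ℝ] Big V :=
  c.prodMap (-(ContinuousLinearMap.precomp ℝ c))

theorem bigActL_apply (c : V →L[ℝ] V) (u : Big V) : bigActL c u = bigAct c u := rfl

/-- The covariant derivative of an endomorphism field of `V × V*` with value `Φ` and differential
`dΦ`, for the connection with Christoffel symbols `C`. -/
def nablaBig (C : V →L[ℝ] V →L[ℝ] V) (Φ : Big V →L[ℝ] Big V)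
    (dΦ : V →L[ℝ] Big V →L[ℝ] Big V) (v : V) : Big V →L[ℝ] Big V :=
  dΦ v + (bigActL (C v)).comp Φ - Φ.comp (bigActL (C v))

theorem nablaBig_apply (C : V →L[ℝ] V →L[ℝ] V) (Φ : Big V →L[ℝ] Big V)
    (dΦ : V →L[ℝ] Big V →L[ℝ] Big V) (v : V) (a : Big V) :
    nablaBig C Φ dΦ v a = dΦ v a + bigAct (C v) (Φ a) - Φ (bigAct (C v) a) := rfl

theorem pair_bigAct (c : V →L[ℝ] V) (a b : Big V) : pair (bigAct c a) b = -pair a (bigAct c b) := by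
  simp [pair, bigAct]
  ring

/-- Leibniz rule: the term containing ∇S drops out. -/
theorem nablaBig_comp_apply {C : V →L[ℝ] V →L[ℝ] V} {S Φ : Big V →L[ℝ] Big V}
    {dS dΦ D : V →L[ℝ] Big V →L[ℝ] Big V}
    (hD : ∀ v, D v = S.comp (dΦ v) + (dS v).comp Φ) (hS : ∀ v, nablaBig C S dS v = 0) (v : V)
    (a : Big V) : nablaBig C (S.comp Φ) D v a = S (nablaBig C Φ dΦ v a) := by
  have h := DFunLike.congr_fun (hS v) (Φ a)
  rw [nablaBig_apply, zero_apply] at h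
  simp only [nablaBig_apply, add_apply, ContinuousLinearMap.comp_apply, hD, map_add, map_sub]
  rw [← sub_eq_zero, ← h]
  abel

theorem nablaBig_neg (C : V →L[ℝ] V →L[ℝ] V) (Φ : Big V →L[ℝ] Big V)
    (dΦ : V →L[ℝ] Big V →L[ℝ] Big V) (v : V) (a : Big V) :
    nablaBig C Φ dΦ (-v) a = -nablaBig C Φ dΦ v a := by
  have e : ∀ b, bigAct (C (-v)) b = -bigAct (C v) b := fun b => by
    simp [bigAct]
  rw [nablaBig_apply, nablaBig_apply, e, e, map_neg, map_neg, neg_apply]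
  abel

/-- The pairing with a fixed element. -/
def pairL (b : Big V) : Big V →L[ℝ] ℝ :=
  (1 / 2 : ℝ) • ((ContinuousLinearMap.apply ℝ ℝ b.1).comp (ContinuousLinearMap.snd ℝ _ _)
    + b.2.comp (ContinuousLinearMap.fst ℝ _ _))

theorem pairL_apply (a b : Big V) : pairL b a = pair a b := by
  simp [pairL, pair]
  ring

variable {C : V →L[ℝ] V →L[ℝ] V} {y₀ : V} {Φ' S' : V → Big V →L[ℝ] Big V}
  {dΦ dS : V →L[ℝ] Big V →L[ℝ] Big V}

/-- The identity gets differentiated, so it is required on a neighbourhood of `y₀`. The connection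
part is a commutator of two skew endomorphisms, hence skew. -/
theorem nablaBig_skew (hd : HasFDerivAt Φ' dΦ y₀)
    (h : ∀ᶠ y in 𝓝 y₀, ∀ a b, pair (Φ' y a) b = -pair a (Φ' y b)) (v : V) (a b : Big V) :
    pair (nablaBig C (Φ' y₀) dΦ v a) b = -pair a (nablaBig C (Φ' y₀) dΦ v b) := by
  have h1 : HasFDerivAt (fun y => pairL b (Φ' y a)) _ y₀ :=
    (pairL b).hasFDerivAt.comp y₀ (hd.clm_apply (hasFDerivAt_const a y₀))
  have h2 : HasFDerivAt (fun y => -pairL a (Φ' y b)) _ y₀ :=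
    ((pairL a).hasFDerivAt.comp y₀ (hd.clm_apply (hasFDerivAt_const b y₀))).neg
  have h3 : (fun y => pairL b (Φ' y a)) =ᶠ[𝓝 y₀] fun y => -pairL a (Φ' y b) := by
    filter_upwards [h] with y hy
    rw [pairL_apply, pairL_apply, hy, pair_comm]
  have h4 := DFunLike.congr_fun (h1.unique (h2.congr_of_eventuallyEq h3)) v
  simp only [ContinuousLinearMap.comp_apply, add_apply, neg_apply, zero_apply, map_zero, zero_add,
    ContinuousLinearMap.flip_apply, pairL_apply] at h4
  have hs := h.self_of_nhds
  have e1 : pair (bigAct (C v) (Φ' y₀ a)) b = pair a (Φ' y₀ (bigAct (C v) b)) := by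
    rw [pair_bigAct, hs, neg_neg]
  have e2 : pair (Φ' y₀ (bigAct (C v) a)) b = pair a (bigAct (C v) (Φ' y₀ b)) := by
    rw [hs, pair_bigAct, neg_neg]
  rw [nablaBig_apply, nablaBig_apply, pair_sub_left, pair_add_left, pair_sub_right, pair_add_right,
    h4, e1, e2, pair_comm a (dΦ v b)]
  ring

theorem nablaBig_anticomm (hd : HasFDerivAt Φ' dΦ y₀)
    (h : ∀ᶠ y in 𝓝 y₀, ∀ a, Φ' y (Φ' y a) = -a) (v : V) (a : Big V) :
    nablaBig C (Φ' y₀) dΦ v (Φ' y₀ a) = -Φ' y₀ (nablaBig C (Φ' y₀) dΦ v a) := by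
  have h1 : HasFDerivAt (fun y => Φ' y (Φ' y a)) _ y₀ :=
    hd.clm_apply (hd.clm_apply (hasFDerivAt_const a y₀))
  have h3 : (fun y => Φ' y (Φ' y a)) =ᶠ[𝓝 y₀] fun y => -a := by
    filter_upwards [h] with y hy using hy a
  have h4 := DFunLike.congr_fun
    (h1.unique ((hasFDerivAt_const (-a) y₀).congr_of_eventuallyEq h3)) v
  simp only [ContinuousLinearMap.comp_apply, add_apply, zero_apply, map_zero, zero_add,
    ContinuousLinearMap.flip_apply] at h4
  have hs := h.self_of_nhds
  have h5 : bigAct (C v) (-a) = -bigAct (C v) a := by rw [← bigActL_apply, map_neg, bigActL_apply]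
  rw [nablaBig_apply, nablaBig_apply, map_sub, map_add, hs, hs, h5,
    eq_neg_of_add_eq_zero_right h4]
  abel

/-- Differentiating SΦ = ΦS and using ∇S = 0 to express `dS` by the connection shows that ∇Φ
preserves the eigenspaces of `S`. -/
theorem nablaBig_comm (hd : HasFDerivAt Φ' dΦ y₀) (hdS : HasFDerivAt S' dS y₀)
    (h : ∀ᶠ y in 𝓝 y₀, ∀ a, S' y (Φ' y a) = Φ' y (S' y a))
    (hS : ∀ v, nablaBig C (S' y₀) dS v = 0) (v : V) (a : Big V) :
    S' y₀ (nablaBig C (Φ' y₀) dΦ v a) = nablaBig C (Φ' y₀) dΦ v (S' y₀ a) := by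
  have h1 : HasFDerivAt (fun y => S' y (Φ' y a)) _ y₀ :=
    hdS.clm_apply (hd.clm_apply (hasFDerivAt_const a y₀))
  have h2 : HasFDerivAt (fun y => Φ' y (S' y a)) _ y₀ :=
    hd.clm_apply (hdS.clm_apply (hasFDerivAt_const a y₀))
  have h3 : (fun y => S' y (Φ' y a)) =ᶠ[𝓝 y₀] fun y => Φ' y (S' y a) := by
    filter_upwards [h] with y hy using hy a
  have h4 := DFunLike.congr_fun (h1.unique (h2.congr_of_eventuallyEq h3)) v
  simp only [ContinuousLinearMap.comp_apply, add_apply, zero_apply, map_zero, zero_add,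
    ContinuousLinearMap.flip_apply] at h4
  have hs := h.self_of_nhds
  have e1 : ∀ b, dS v b = S' y₀ (bigAct (C v) b) - bigAct (C v) (S' y₀ b) := fun b => by
    have := DFunLike.congr_fun (hS v) b
    rw [nablaBig_apply, zero_apply] at this
    rw [← sub_eq_zero, ← this]
    abel
  rw [e1, e1, map_sub, hs] at h4
  rw [nablaBig_apply, nablaBig_apply, map_sub, map_add, hs]
  rw [← sub_eq_zero] at h4 ⊢
  rw [← h4]
  abel

end Parallel

/-! ### Integrability and generalized Kähler structures on a manifold -/

section Manifold

variable {E : Type*} [NormedAddCommGroup E] [NormedSpace ℝ E]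
  {H : Type*} [TopologicalSpace H] (I : ModelWithCorners ℝ E H)
  {M : Type*} [TopologicalSpace M] [ChartedSpace H M]

/-- The big tangent bundle in the chart around `x₀`. -/
def bigCoframe (x₀ : M) (y : E) (a : Big E) : Big E := (coframe I x₀ y a.1, a.2.comp (frame I x₀ y))

/-- The inverse of `bigCoframe`. -/
def bigFrame (x₀ : M) (y : E) (a : Big E) : Big E := (frame I x₀ y a.1, a.2.comp (coframe I x₀ y))

/-- The Courant bracket of sections read in the model space. -/
def courantE (s t : M → Big E) : M → Big E := courant (M := M) I s t

/-- `Φ'` is the expression of the field `Φ` in the chart around `x₀`. -/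
def IsChartRep (x₀ : M) (Φ : M → Big E →L[ℝ] Big E) (Φ' : E → Big E →L[ℝ] Big E) : Prop :=
  ∀ᶠ y in 𝓝 (extChartAt I x₀ x₀), ∀ s : M → Big E,
    secHat I x₀ (fun x => Φ x (s x)) y = Φ' y (secHat I x₀ s y)

variable {I} in
theorem IsChartRep.comp {x₀ : M} {Φ Ψ : M → Big E →L[ℝ] Big E} {Φ' Ψ' : E → Big E →L[ℝ] Big E}
    (hΦ : IsChartRep I x₀ Φ Φ') (hΨ : IsChartRep I x₀ Ψ Ψ') :
    IsChartRep I x₀ (fun x => (Φ x).comp (Ψ x)) (fun y => (Φ' y).comp (Ψ' y)) := by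
  filter_upwards [hΦ, hΨ] with y h1 h2 s
  rw [ContinuousLinearMap.comp_apply, ← h2, ← h1]
  rfl

variable [IsManifold I ∞ M] [I.Boundaryless]

omit [I.Boundaryless] in
theorem bigCoframe_bigFrame {x₀ : M} {y : E} (hy : y ∈ (extChartAt I x₀).target) (a : Big E) :
    bigCoframe I x₀ y (bigFrame I x₀ y a) = a := by
  refine Prod.ext (coframe_frame I hy _) (ContinuousLinearMap.ext fun v => ?_)
  exact congrArg a.2 (coframe_frame I hy v)

omit [I.Boundaryless] in
theorem pair_bigCoframe {x₀ : M} {y : E} (hy : y ∈ (extChartAt I x₀).target) (a b : Big E) :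
    pair (bigCoframe I x₀ y a) (bigCoframe I x₀ y b) = pair a b := by
  simp only [pair, bigCoframe, ContinuousLinearMap.comp_apply, frame_coframe I hy]

omit [IsManifold I ∞ M] in
variable {I} in
theorem IsChartRep.eventually_apply {x₀ : M} {Φ : M → Big E →L[ℝ] Big E}
    {Φ' : E → Big E →L[ℝ] Big E} (hΦ : IsChartRep I x₀ Φ Φ') :
    ∀ᶠ y in 𝓝 (extChartAt I x₀ x₀), y ∈ (extChartAt I x₀).target ∧ ∀ a,
      Φ' y (bigCoframe I x₀ y a) = bigCoframe I x₀ y (Φ ((extChartAt I x₀).symm y) a) := by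
  filter_upwards [hΦ, eventually_mem_target I x₀] with y h1 h2
  exact ⟨h2, fun a => (h1 fun _ => a).symm⟩

variable {I} in
theorem IsChartRep.eventually_skew {x₀ : M} {Φ : M → Big E →L[ℝ] Big E}
    {Φ' : E → Big E →L[ℝ] Big E} (hΦ : IsChartRep I x₀ Φ Φ')
    (h : ∀ x a b, pair (Φ x a) b = -pair a (Φ x b)) :
    ∀ᶠ y in 𝓝 (extChartAt I x₀ x₀), ∀ a b, pair (Φ' y a) b = -pair a (Φ' y b) := by
  filter_upwards [hΦ.eventually_apply] with y ⟨hy, h1⟩ a b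
  rw [← bigCoframe_bigFrame I hy a, ← bigCoframe_bigFrame I hy b, h1, h1, pair_bigCoframe I hy,
    pair_bigCoframe I hy, h]

variable {I} in
theorem IsChartRep.eventually_sq {x₀ : M} {Φ : M → Big E →L[ℝ] Big E}
    {Φ' : E → Big E →L[ℝ] Big E} (hΦ : IsChartRep I x₀ Φ Φ') (h : ∀ x a, Φ x (Φ x a) = -a) :
    ∀ᶠ y in 𝓝 (extChartAt I x₀ x₀), ∀ a, Φ' y (Φ' y a) = -a := by
  filter_upwards [hΦ.eventually_apply] with y ⟨hy, h1⟩ a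
  have e : ∀ b, bigCoframe I x₀ y (-b) = -bigCoframe I x₀ y b := fun b =>
    Prod.ext (map_neg (coframe I x₀ y) b.1) rfl
  rw [← bigCoframe_bigFrame I hy a, h1, h1, h, e]

variable {I} in
theorem IsChartRep.eventually_comm {x₀ : M} {Φ S : M → Big E →L[ℝ] Big E}
    {Φ' S' : E → Big E →L[ℝ] Big E} (hΦ : IsChartRep I x₀ Φ Φ') (hS : IsChartRep I x₀ S S')
    (h : ∀ x a, S x (Φ x a) = Φ x (S x a)) :
    ∀ᶠ y in 𝓝 (extChartAt I x₀ x₀), ∀ a, S' y (Φ' y a) = Φ' y (S' y a) := by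
  filter_upwards [hΦ.eventually_apply, hS.eventually_apply] with y ⟨hy, h1⟩ ⟨_, h2⟩ a
  rw [← bigCoframe_bigFrame I hy a, h1, h2, h2, h1, h]

omit [I.Boundaryless] in
variable {I} in
theorem IsChartRep.self {x₀ : M} {Φ : M → Big E →L[ℝ] Big E} {Φ' : E → Big E →L[ℝ] Big E}
    (hΦ : IsChartRep I x₀ Φ Φ') : Φ' (extChartAt I x₀ x₀) = Φ x₀ := by
  refine ContinuousLinearMap.ext fun u => ?_
  have h := hΦ.self_of_nhds fun _ => u
  rw [secHat_self, secHat_self] at h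
  exact h.symm

theorem smoothSection_iff (s : M → Big E) : SmoothSection I (M := M) s ↔
    ∀ x₀ : M, ContDiffAt ℝ ∞ (secHat I x₀ s) (extChartAt I x₀ x₀) := by
  refine (and_congr (smoothVec_iff I _) (smoothForm_iff I _)).trans ?_
  rw [← forall_and]
  exact forall_congr' fun x₀ => ⟨fun h => h.1.prodMk h.2, fun h => ⟨h.fst, h.snd⟩⟩

theorem smoothBigEnd_of_chartRep {Φ : M → Big E →L[ℝ] Big E}
    (h : ∀ x₀ : M, ∃ Φ' : E → Big E →L[ℝ] Big E, IsChartRep I x₀ Φ Φ' ∧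
      ContDiffAt ℝ ∞ Φ' (extChartAt I x₀ x₀)) : SmoothBigEnd I (M := M) Φ := by
  intro s hs
  refine (smoothSection_iff I fun x => Φ x (s x)).2 fun x₀ => ?_
  obtain ⟨Φ', h1, h2⟩ := h x₀
  refine (h2.clm_apply ((smoothSection_iff I s).1 hs x₀)).congr_of_eventuallyEq ?_
  filter_upwards [h1] with y hy using hy s

variable {I} in
theorem IsChartRep.hasFDerivAt {x₀ : M} {Φ : M → Big E →L[ℝ] Big E} {Φ' : E → Big E →L[ℝ] Big E}
    (hΦ : IsChartRep I x₀ Φ Φ') {dΦ : E →L[ℝ] Big E →L[ℝ] Big E}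
    (hd : HasFDerivAt Φ' dΦ (extChartAt I x₀ x₀)) {s : M → Big E} {ds : E →L[ℝ] Big E}
    (hs : HasFDerivAt (secHat I x₀ s) ds (extChartAt I x₀ x₀)) :
    HasFDerivAt (secHat I x₀ fun x => Φ x (s x)) ((Φ x₀).comp ds + dΦ.flip (s x₀))
      (extChartAt I x₀ x₀) := by
  have h := hd.clm_apply hs
  rw [hΦ.self, secHat_self] at h
  refine h.congr_of_eventuallyEq ?_
  filter_upwards [hΦ] with y hy using hy s

/-- A section of the √-1-eigenbundle has the form Φs + √-1 s. The real and imaginary parts of the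
bracket of two such sections are paired with `w` and Φw, which is the combination required by
`eigen_iff`. -/
theorem pair_courant_eq_obstruction {x₀ : M} {Φ : M → Big E →L[ℝ] Big E}
    {Φ' : E → Big E →L[ℝ] Big E} (hΦ : IsChartRep I x₀ Φ Φ') {dΦ : E →L[ℝ] Big E →L[ℝ] Big E}
    (hd : HasFDerivAt Φ' dΦ (extChartAt I x₀ x₀))
    (hskew : ∀ a b, pair (Φ x₀ a) b = -pair a (Φ x₀ b)) (hsq : ∀ a, Φ x₀ (Φ x₀ a) = -a)
    {C : E →L[ℝ] E →L[ℝ] E} (hC : ∀ v w, C v w = C w v)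
    {s t : M → Big E} (hs : SmoothSection I (M := M) s) (ht : SmoothSection I (M := M) t)
    (w : Big E) :
    pair (courantE I (fun x => Φ x (s x)) (fun x => Φ x (t x)) x₀ - courantE I s t x₀) w
      + pair (courantE I (fun x => Φ x (s x)) t x₀ + courantE I s (fun x => Φ x (t x)) x₀) (Φ x₀ w)
      = obstruction (Φ x₀) (fun v => nablaBig C (Φ x₀) dΦ v) (s x₀) (t x₀) w := by
  have hs' := (((smoothSection_iff I s).1 hs x₀).differentiableAt (by simp)).hasFDerivAt
  have ht' := (((smoothSection_iff I t).1 ht x₀).differentiableAt (by simp)).hasFDerivAt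
  have hΦs := hΦ.hasFDerivAt hd hs'
  have hΦt := hΦ.hasFDerivAt hd ht'
  have c : ∀ {s t : M → Big E} {ds dt : E →L[ℝ] Big E},
      HasFDerivAt (secHat I x₀ s) ds (extChartAt I x₀ x₀) →
      HasFDerivAt (secHat I x₀ t) dt (extChartAt I x₀ x₀) →
      courantE I s t x₀ = courJet (s x₀) ds (t x₀) dt := courant_eq_chart I
  rw [c hs' ht', c hs' hΦt, c hΦs ht', c hΦs hΦt, pair_sub_left, pair_add_left]
  simp only [pair_courJet hC]
  rw [← courPair_eq_obstruction _ hskew hsq _ _ _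
    (fun v => fderiv ℝ (secHat I x₀ s) (extChartAt I x₀ x₀) v + bigAct (C v) (s x₀))
    (fun v => fderiv ℝ (secHat I x₀ t) (extChartAt I x₀ x₀) v + bigAct (C v) (t x₀))]
  have e : ∀ (r : M → Big E) (dr : E →L[ℝ] Big E), (fun v => ((Φ x₀).comp dr + dΦ.flip (r x₀)) v
      + bigAct (C v) (Φ x₀ (r x₀))) = fun v => nablaBig C (Φ x₀) dΦ v (r x₀)
        + Φ x₀ (dr v + bigAct (C v) (r x₀)) := by
    intro r dr
    funext v
    rw [nablaBig_apply, map_add]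
    simp only [add_apply, ContinuousLinearMap.comp_apply, ContinuousLinearMap.flip_apply]
    abel
  rw [e, e]
  ring

variable [FiniteDimensional ℝ E] [T2Space M]

omit [I.Boundaryless] in
theorem exists_smoothSection_eq (x₀ : M) (a : Big E) :
    ∃ s : M → Big E, SmoothSection I (M := M) s ∧ s x₀ = a := by
  obtain ⟨X, hX, hX'⟩ := exists_smoothVec_eq I x₀ a.1
  obtain ⟨α, hα, hα'⟩ := exists_smoothForm_eq I x₀ a.2
  exact ⟨fun x => (X x, α x), ⟨hX, hα⟩, Prod.ext hX' hα'⟩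

/-- The obstruction depends only on values at `x₀`, and every pair of values is attained by global
smooth sections. -/
theorem isIntegrable_iff_obstruction {Φ : M → Big E →L[ℝ] Big E}
    (hΦ : IsGenAlmostComplex I (M := M) Φ) {Φ' : M → E → Big E →L[ℝ] Big E}
    (hrep : ∀ x₀, IsChartRep I x₀ Φ (Φ' x₀)) {dΦ : M → E →L[ℝ] Big E →L[ℝ] Big E}
    (hd : ∀ x₀, HasFDerivAt (Φ' x₀) (dΦ x₀) (extChartAt I x₀ x₀))
    {C : M → E →L[ℝ] E →L[ℝ] E} (hC : ∀ x₀ v w, C x₀ v w = C x₀ w v) :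
    IsIntegrable I (M := M) Φ ↔ ∀ x₀ a b w,
      obstruction (Φ x₀) (fun v => nablaBig (C x₀) (Φ x₀) (dΦ x₀) v) a b w = 0 := by
  have hskew : ∀ x a b, pair (Φ x a) b = -pair a (Φ x b) := fun x a b =>
    eq_neg_of_add_eq_zero_left (hΦ.skew x a b)
  have hsq : ∀ x a, Φ x (Φ x a) = -a := hΦ.sq
  constructor
  · intro h x₀ a b w
    obtain ⟨s, hs, rfl⟩ := exists_smoothSection_eq I x₀ a
    obtain ⟨t, ht, rfl⟩ := exists_smoothSection_eq I x₀ b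
    have h1 := h (fun x => Φ x (s x)) s (fun x => Φ x (t x)) t (hΦ.smooth s hs) hs
      (hΦ.smooth t ht) ht (fun x => ⟨hsq x _, rfl⟩) (fun x => ⟨hsq x _, rfl⟩) x₀
    exact (pair_courant_eq_obstruction I (hrep x₀) (hd x₀) (hskew x₀) (hsq x₀) (hC x₀) hs ht
      w).symm.trans ((eigen_iff (V := E) (hskew x₀) (hsq x₀) _ _).1 h1 w)
  · intro h u s u' t _ hs _ ht h1 h2 x₀
    -- The imaginary part of an eigensection determines its real part.
    obtain rfl : (fun x => Φ x (s x)) = u := funext fun x => (h1 x).2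
    obtain rfl : (fun x => Φ x (t x)) = u' := funext fun x => (h2 x).2
    refine (eigen_iff (V := E) (hskew x₀) (hsq x₀) _ _).2 fun w => ?_
    exact (pair_courant_eq_obstruction I (hrep x₀) (hd x₀) (hskew x₀) (hsq x₀) (hC x₀) hs ht
      w).trans (h _ _ _ _)

/-- A generalized almost complex structure which is skew-symmetric for a parallel generalized
Riemannian metric defines a generalized Kähler structure if and only if it is parallel. -/
theorem isGenKahler_iff_parallel {S Φ : M → Big E →L[ℝ] Big E}
    (hΦ : IsGenAlmostComplex I (M := M) Φ) (hS : IsGenRiemannianMetric I (M := M) S)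
    (hSΦ : ∀ x a, S x (Φ x a) = Φ x (S x a))
    {Φ' S' : M → E → Big E →L[ℝ] Big E}
    (hrep : ∀ x₀, IsChartRep I x₀ Φ (Φ' x₀)) {dΦ : M → E →L[ℝ] Big E →L[ℝ] Big E}
    (hd : ∀ x₀, HasFDerivAt (Φ' x₀) (dΦ x₀) (extChartAt I x₀ x₀))
    (hrepS : ∀ x₀, IsChartRep I x₀ S (S' x₀)) {dS : M → E →L[ℝ] Big E →L[ℝ] Big E}
    (hdS : ∀ x₀, HasFDerivAt (S' x₀) (dS x₀) (extChartAt I x₀ x₀))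
    {C : M → E →L[ℝ] E →L[ℝ] E} (hC : ∀ x₀ v w, C x₀ v w = C x₀ w v)
    (hSpar : ∀ x₀ v, nablaBig (C x₀) (S x₀) (dS x₀) v = 0)
    (hsurj : ∀ (x₀ : M) (ε : ℝ), ε = 1 ∨ ε = -1 → ∀ v : E, ∃ w : Big E, S x₀ w = ε • w ∧ w.1 = v) :
    IsGenKahler I (M := M) S Φ ↔ ∀ x₀ v, nablaBig (C x₀) (Φ x₀) (dΦ x₀) v = 0 := by
  have hskew : ∀ x a b, pair (Φ x a) b = -pair a (Φ x b) := fun x a b =>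
    eq_neg_of_add_eq_zero_left (hΦ.skew x a b)
  have hsq : ∀ x a, Φ x (Φ x a) = -a := hΦ.sq
  have hSsq : ∀ x a, S x (S x a) = a := hS.sq
  have hSiso : ∀ x a b, pair (S x a) (S x b) = pair a b := hS.isometry
  have hSsym : ∀ x a b, pair (S x a) b = pair a (S x b) := fun x a b => by
    rw [← hSiso x (S x a), hSsq]
  have hSΦac : IsGenAlmostComplex I (M := M) (fun x => (S x).comp (Φ x)) := by
    refine ⟨fun s hs => hS.smooth _ (hΦ.smooth s hs), fun x (a b : Big E) => ?_,
      fun x (a : Big E) => ?_⟩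
    · have : pair (S x (Φ x a)) b + pair a (S x (Φ x b)) = 0 := by
        rw [hSsym, hskew, ← hSΦ]
        ring
      exact this
    · have : S x (Φ x (S x (Φ x a))) = -a := by rw [hSΦ, hSsq, hsq]
      exact this
  have hrep' : ∀ x₀, IsChartRep I x₀ (fun x => (S x).comp (Φ x))
      (fun y => (S' x₀ y).comp (Φ' x₀ y)) := fun x₀ => (hrepS x₀).comp (hrep x₀)
  have hd' : ∀ x₀, ∃ D, HasFDerivAt (fun y => (S' x₀ y).comp (Φ' x₀ y)) D (extChartAt I x₀ x₀)
      ∧ ∀ v, D v = (S x₀).comp (dΦ x₀ v) + (dS x₀ v).comp (Φ x₀) :=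
    fun x₀ => ⟨_, (hdS x₀).clm_comp (hd x₀), fun v => by
      rw [← (hrep x₀).self, ← (hrepS x₀).self]
      rfl⟩
  choose D hD hD' using hd'
  -- As S is parallel, ∇(SΦ) = S∇Φ; the two obstructions are thus governed by the same tensor ∇Φ.
  have hP' : ∀ x v a, nablaBig (C x) ((S x).comp (Φ x)) (D x) v a =
      S x (nablaBig (C x) (Φ x) (dΦ x) v a) := fun x =>
    nablaBig_comp_apply (hD' x) (hSpar x)
  have hSP : ∀ x v a, S x (nablaBig (C x) (Φ x) (dΦ x) v a) =
      nablaBig (C x) (Φ x) (dΦ x) v (S x a) := fun x => by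
    have := nablaBig_comm (C := C x) (hd x) (hdS x) ((hrep x).eventually_comm (hrepS x) hSΦ)
    rw [(hrep x).self, (hrepS x).self] at this
    exact this (hSpar x)
  have hPskew : ∀ x v a b, pair (nablaBig (C x) (Φ x) (dΦ x) v a) b =
      -pair a (nablaBig (C x) (Φ x) (dΦ x) v b) := fun x => by
    rw [← (hrep x).self]
    exact nablaBig_skew (hd x) ((hrep x).eventually_skew hskew)
  have hPanti : ∀ x v a, nablaBig (C x) (Φ x) (dΦ x) v (Φ x a) =
      -Φ x (nablaBig (C x) (Φ x) (dΦ x) v a) := fun x => by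
    rw [← (hrep x).self]
    exact nablaBig_anticomm (hd x) ((hrep x).eventually_sq hsq)
  have hobs : ∀ x a b w, obstruction ((S x).comp (Φ x))
      (fun v => nablaBig (C x) ((S x).comp (Φ x)) (D x) v) a b w = obstruction
      (fun a => S x (Φ x a)) (fun v a => S x (nablaBig (C x) (Φ x) (dΦ x) v a)) a b w :=
    fun x a b w => by
      simp only [← hP']
      rfl
  have i1 := isIntegrable_iff_obstruction I hΦ hrep hd hC
  have i2 := isIntegrable_iff_obstruction I hSΦac hrep' hD hC
  have hzero : ∀ a : Big E, pair 0 a = 0 := fun a => by simp [pair]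
  constructor
  · intro h x₀ v
    refine ContinuousLinearMap.ext fun a => ?_
    refine parallel_of_obstruction_eq_zero (Φ := Φ x₀) (S := S x₀)
      (P := nablaBig (C x₀) (Φ x₀) (dΦ x₀)) (hskew x₀) (hsq x₀)
      (nablaBig_neg _ _ _) (hPskew x₀)
      (hPanti x₀) (hSsq x₀) (hSiso x₀) (hSΦ x₀) (hSP x₀) (hsurj x₀) (i1.1 h.integrable x₀)
      (fun a b w => ?_) v a
    exact (hobs _ _ _ _).symm.trans (i2.1 h.integrable_compl x₀ a b w)
  · intro h
    refine ⟨hΦ, hS, fun x (a b : Big E) => ?_, i1.2 fun x a b w => ?_, i2.2 fun x a b w => ?_⟩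
    · have : 2 * pair (S x (Φ x a)) b + 2 * pair (S x a) (Φ x b) = 0 := by
        rw [hSΦ, hskew]
        ring
      exact this
    · simp only [obstruction, h, zero_apply, hzero]
      ring
    · refine (hobs _ _ _ _).trans ?_
      simp only [obstruction, h, zero_apply, map_zero, hzero]
      ring

end Manifold

/-! ### Pointwise algebra of almost contact structures, Blair's theorem, Christoffel symbols -/

section Algebra

variable {V : Type*} [NormedAddCommGroup V] [NormedSpace ℝ V]

/-- An almost contact metric structure on a vector space. -/
structure IsContactAlg (f : V →L[ℝ] V) (z : V) (ξ : V →L[ℝ] ℝ) (g : V →L[ℝ] V →L[ℝ] ℝ) :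
    Prop where
  symm : ∀ v w, g v w = g w v
  pos : ∀ v, v ≠ 0 → 0 < g v v
  ξ_z : ξ z = 1
  f_z : f z = 0
  ξ_f : ∀ v, ξ (f v) = 0
  f_f : ∀ v, f (f v) = -v + ξ v • z
  compat : ∀ v w, g (f v) (f w) = g v w - ξ v * ξ w

namespace IsContactAlg

variable {f : V →L[ℝ] V} {z : V} {ξ : V →L[ℝ] ℝ} {g : V →L[ℝ] V →L[ℝ] ℝ}

theorem g_z (h : IsContactAlg f z ξ g) (w : V) : g z w = ξ w := by
  have h1 := h.compat z w
  rw [h.f_z, h.ξ_z, map_zero, zero_apply] at h1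
  linarith

theorem g_z_right (h : IsContactAlg f z ξ g) (w : V) : g w z = ξ w := by rw [h.symm, h.g_z]

theorem g_f (h : IsContactAlg f z ξ g) (v w : V) : g (f v) w = -g v (f w) := by
  have h1 := h.compat v (f w)
  rw [h.f_f, h.ξ_f, map_add, map_neg, map_smul, h.g_z_right, h.ξ_f, smul_zero] at h1
  linarith

theorem eq_zero_of_forall (h : IsContactAlg f z ξ g) {v : V} (hv : ∀ w, g v w = 0) : v = 0 := by
  by_contra h0
  exact (h.pos v h0).ne' (hv v)

end IsContactAlg

/-- The covariant differential of a field of endomorphisms. -/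
def nablaEnd (C : V →L[ℝ] V →L[ℝ] V) (f : V →L[ℝ] V) (df : V →L[ℝ] V →L[ℝ] V) :
    V →ₗ[ℝ] V →L[ℝ] V where
  toFun v := df v + (C v).comp f - f.comp (C v)
  map_add' v w := by
    ext a
    simp only [map_add, add_apply, sub_apply, ContinuousLinearMap.comp_apply]
    abel
  map_smul' c v := by
    ext a
    simp only [map_smul, smul_apply, add_apply, sub_apply, ContinuousLinearMap.comp_apply,
      smul_add, smul_sub, RingHom.id_apply]

/-- The covariant differential of a vector field. -/
def nablaVec (C : V →L[ℝ] V →L[ℝ] V) (z : V) (dz : V →L[ℝ] V) : V →ₗ[ℝ] V where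
  toFun v := dz v + C v z
  map_add' v w := by
    simp only [map_add, add_apply]
    abel
  map_smul' c v := by
    simp only [map_smul, smul_apply, smul_add, RingHom.id_apply]

/-- The covariant differential of a `1`-form. -/
def nablaForm (C : V →L[ℝ] V →L[ℝ] V) (ξ : V →L[ℝ] ℝ) (dξ : V →L[ℝ] V →L[ℝ] ℝ) :
    V →ₗ[ℝ] V →L[ℝ] ℝ where
  toFun v := dξ v - ξ.comp (C v)
  map_add' v w := by
    ext a
    simp only [map_add, add_apply, sub_apply, ContinuousLinearMap.comp_apply]
    abel
  map_smul' c v := by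
    ext a
    simp only [map_smul, smul_apply, sub_apply, ContinuousLinearMap.comp_apply,
      smul_sub, RingHom.id_apply]

theorem nablaEnd_apply (C : V →L[ℝ] V →L[ℝ] V) (f : V →L[ℝ] V) (df : V →L[ℝ] V →L[ℝ] V) (v a : V) :
    nablaEnd C f df v a = df v a + C v (f a) - f (C v a) := rfl

theorem nablaVec_apply (C : V →L[ℝ] V →L[ℝ] V) (z : V) (dz : V →L[ℝ] V) (v : V) :
    nablaVec C z dz v = dz v + C v z := rfl

theorem nablaForm_apply (C : V →L[ℝ] V →L[ℝ] V) (ξ : V →L[ℝ] ℝ) (dξ : V →L[ℝ] V →L[ℝ] ℝ)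
    (v a : V) : nablaForm C ξ dξ v a = dξ v a - ξ (C v a) := rfl

/-- The identities satisfied by the covariant differentials `Df`, `Dz`, `Dξ` of an almost contact
metric structure with respect to a metric connection. -/
structure IsContactJet (f : V →L[ℝ] V) (z : V) (ξ : V →L[ℝ] ℝ) (g : V →L[ℝ] V →L[ℝ] ℝ)
    (Df : V →ₗ[ℝ] V →L[ℝ] V) (Dz : V →ₗ[ℝ] V) (Dξ : V →ₗ[ℝ] V →L[ℝ] ℝ) : Prop where
  alg : IsContactAlg f z ξ g
  f_z : ∀ u, Df u z + f (Dz u) = 0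
  ξ_z : ∀ u, Dξ u z + ξ (Dz u) = 0
  g_z : ∀ u w, g (Dz u) w = Dξ u w
  f_f : ∀ u v, Df u (f v) + f (Df u v) = Dξ u v • z + ξ v • Dz u
  skew : ∀ u v w, g (Df u v) w = -g v (Df u w)

/-- The pointwise form of Blair's condition for a structure with covariant differentials `Df`,
`Dξ`: `dξ = 0`, `dΞ = 0` and the Nijenhuis tensor vanishes. -/
structure IsBlairJet (f : V →L[ℝ] V) (g : V →L[ℝ] V →L[ℝ] ℝ)
    (Df : V →ₗ[ℝ] V →L[ℝ] V) (Dξ : V →ₗ[ℝ] V →L[ℝ] ℝ) : Prop where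
  symm : ∀ u v, Dξ u v = Dξ v u
  cyclic : ∀ u v w, g (Df u v) w + g (Df v w) u + g (Df w u) v = 0
  nijenhuis : ∀ u v, Df (f u) v - Df (f v) u - f (Df u v) + f (Df v u) = 0

variable {f : V →L[ℝ] V} {z : V} {ξ : V →L[ℝ] ℝ} {g : V →L[ℝ] V →L[ℝ] ℝ}
  {Df : V →ₗ[ℝ] V →L[ℝ] V} {Dz : V →ₗ[ℝ] V} {Dξ : V →ₗ[ℝ] V →L[ℝ] ℝ}

namespace IsContactJet

/-- The derivative of FZ = 0 trades ∇F applied to Z for ∇Z, and ∇Z is metrically dual to ∇ξ. -/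
theorem g_Df_z (h : IsContactJet f z ξ g Df Dz Dξ) (u v : V) : g (Df u z) v = Dξ u (f v) := by
  rw [eq_neg_of_add_eq_zero_left (h.f_z u), map_neg, neg_apply, h.alg.g_f, neg_neg, h.g_z]

theorem g_Df_z_right (h : IsContactJet f z ξ g Df Dz Dξ) (u v : V) :
    g (Df u v) z = -Dξ u (f v) := by rw [h.skew, h.alg.symm, h.g_Df_z]

/-- The Nijenhuis condition at (u, z), combined with the cyclic identity and the symmetry of Dξ,
kills Dξ on the image of f. The direction z is handled by |z| = 1. -/
theorem form_eq_zero (h : IsContactJet f z ξ g Df Dz Dξ) (hB : IsBlairJet f g Df Dξ) (u v : V) :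
    Dξ u v = 0 := by
  have hz : ∀ u, Dξ u z = 0 := fun u => by
    have e1 := h.ξ_z u
    have e2 := h.g_z u z
    rw [h.alg.g_z_right] at e2
    linarith
  -- The cyclic identity at (z, u, fv) eliminates the derivative of F along z. The terms Dξ(u, f²v)
  -- cancel, and what remains is 2Dξ(fu, fv).
  have a3 : ∀ u v, Dξ (f u) (f v) = 0 := fun u v => by
    have e := congrArg (fun a => g a v) (hB.nijenhuis u z)
    have e2 := hB.cyclic z u (f v)
    have e3 := hB.symm (f v) (f u)
    simp only [map_sub, map_add, map_zero, sub_apply, add_apply, zero_apply, h.alg.f_z,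
      h.alg.g_f, h.g_Df_z, h.g_Df_z_right] at e e2
    linarith
  have a4 : ∀ u v, Dξ (f u) v = 0 := fun u v => by
    have e := a3 u (f v)
    rw [h.alg.f_f, map_add, map_neg, map_smul, hz, smul_zero] at e
    linarith
  have e := a4 (f v) u
  rw [h.alg.f_f, map_add, map_neg, map_smul, add_apply, neg_apply, smul_apply, hB.symm z, hz,
    hB.symm v, smul_zero] at e
  linarith

theorem vec_eq_zero (h : IsContactJet f z ξ g Df Dz Dξ) (hξ : ∀ u v, Dξ u v = 0) (u : V) :
    Dz u = 0 :=
  h.alg.eq_zero_of_forall fun w => (h.g_z u w).trans (hξ u w)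

/-- With Dξ = 0 this is the Kähler argument: the derivative of F is recovered from dΞ and the
Nijenhuis tensor. -/
theorem end_eq_zero (h : IsContactJet f z ξ g Df Dz Dξ) (hB : IsBlairJet f g Df Dξ)
    (hξ : ∀ u v, Dξ u v = 0) (u v : V) : Df u v = 0 := by
  have hff : ∀ u v w, g (Df u (f v)) w = g (Df u v) (f w) := fun u v w => by
    have e := congrArg (fun a => g a w) (h.f_f u v)
    simp only [map_add, add_apply, hξ, h.vec_eq_zero hξ, h.alg.g_f, smul_zero,
      zero_smul, map_zero, zero_apply] at e
    linarith
  -- Subtracting the cyclic identities at (fu, v, w) and (fv, u, w) from the Nijenhuis identity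
  -- leaves two equal terms, since Df anticommutes with f and is skew.
  have key : ∀ u v w, g (Df w (f u)) v = 0 := fun u v w => by
    have e := congrArg (fun a => g a w) (hB.nijenhuis u v)
    have e1 := hB.cyclic (f u) v w
    have e2 := hB.cyclic (f v) u w
    simp only [map_sub, map_add, map_zero, sub_apply, add_apply, zero_apply, h.alg.g_f] at e
    have s : ∀ a b c, g (Df a b) c = -g (Df a c) b := fun a b c => by
      rw [h.skew, h.alg.symm]
    have f1 := hff v w u
    have f2 := s v (f w) u
    have f3 := hff u w v
    have f4 := s u (f w) v
    have f5 := s w (f v) u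
    have f6 := hff w u v
    linarith
  refine h.alg.eq_zero_of_forall fun w => ?_
  have e := key (f v) w u
  rw [h.alg.f_f, map_add, map_neg, map_smul, map_add, map_neg, map_smul, add_apply, neg_apply,
    smul_apply, h.g_Df_z, hξ, smul_zero] at e
  linarith

/-- An almost contact metric structure satisfies Blair's condition if and only if it is
parallel. -/
theorem isBlairJet_iff (h : IsContactJet f z ξ g Df Dz Dξ) :
    IsBlairJet f g Df Dξ ↔ Df = 0 ∧ Dz = 0 ∧ Dξ = 0 := by
  constructor
  · intro hB
    have hξ := h.form_eq_zero hB
    refine ⟨LinearMap.ext fun u => ContinuousLinearMap.ext fun v => h.end_eq_zero hB hξ u v,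
      LinearMap.ext fun u => h.vec_eq_zero hξ u,
      LinearMap.ext fun u => ContinuousLinearMap.ext fun v => hξ u v⟩
  · rintro ⟨rfl, -, rfl⟩
    constructor <;> simp

end IsContactJet

/-- The covariant differentials of an almost contact metric structure near a point. -/
theorem isContactJet_of_eventually {f : V → V →L[ℝ] V} {z : V → V} {ξ : V → V →L[ℝ] ℝ}
    {g : V → V →L[ℝ] V →L[ℝ] ℝ} {df : V →L[ℝ] V →L[ℝ] V} {dz : V →L[ℝ] V}
    {dξ : V →L[ℝ] V →L[ℝ] ℝ} {dg : V →L[ℝ] V →L[ℝ] V →L[ℝ] ℝ} {y : V}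
    (h : ∀ᶠ y in 𝓝 y, IsContactAlg (f y) (z y) (ξ y) (g y))
    (hf : HasFDerivAt f df y) (hz : HasFDerivAt z dz y) (hξ : HasFDerivAt ξ dξ y)
    (hg : HasFDerivAt g dg y) {C : V →L[ℝ] V →L[ℝ] V}
    (hC : ∀ v a b, dg v a b = g y (C v a) b + g y a (C v b)) :
    IsContactJet (f y) (z y) (ξ y) (g y) (nablaEnd C (f y) df) (nablaVec C (z y) dz)
      (nablaForm C (ξ y) dξ) := by
  have h0 := h.self_of_nhds
  have ca : ∀ a : V, HasFDerivAt (fun _ : V => a) (0 : V →L[ℝ] V) y :=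
    fun a => hasFDerivAt_const a y
  -- Each structural identity holds near `y`, so its two sides have the same differential. The
  -- Christoffel terms are inserted only afterwards.
  have d1 : ∀ u, df u (z y) + f y (dz u) = 0 := fun u => by
    have e := (hf.clm_apply hz).unique ((hasFDerivAt_const (0 : V) y).congr_of_eventuallyEq
      (h.mono fun y hy => hy.f_z))
    have := DFunLike.congr_fun e u
    simp only [add_apply, ContinuousLinearMap.comp_apply, ContinuousLinearMap.flip_apply,
      zero_apply] at this
    rw [add_comm]
    exact this
  have d2 : ∀ u, dξ u (z y) + ξ y (dz u) = 0 := fun u => by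
    have e := (hξ.clm_apply hz).unique ((hasFDerivAt_const (1 : ℝ) y).congr_of_eventuallyEq
      (h.mono fun y hy => hy.ξ_z))
    have := DFunLike.congr_fun e u
    simp only [add_apply, ContinuousLinearMap.comp_apply, ContinuousLinearMap.flip_apply,
      zero_apply] at this
    rw [add_comm]
    exact this
  have d3 : ∀ u w, dg u (z y) w + g y (dz u) w = dξ u w := fun u w => by
    have e := ((hg.clm_apply hz).clm_apply (ca w)).unique
      ((hξ.clm_apply (ca w)).congr_of_eventuallyEq (h.mono fun y hy => hy.g_z w))
    have := DFunLike.congr_fun e u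
    simp only [add_apply, ContinuousLinearMap.comp_apply, ContinuousLinearMap.flip_apply,
      zero_apply, map_zero, zero_add] at this
    rw [add_comm]
    exact this
  have d5 : ∀ u v, df u (f y v) + f y (df u v) = dξ u v • z y + ξ y v • dz u := fun u v => by
    have e := (hf.clm_apply (hf.clm_apply (ca v))).unique
      ((((hξ.clm_apply (ca v)).smul hz).const_add (-v)).congr_of_eventuallyEq
        (h.mono fun y hy => hy.f_f v))
    have := DFunLike.congr_fun e u
    simp only [add_apply, ContinuousLinearMap.comp_apply, ContinuousLinearMap.flip_apply,
      zero_apply, map_zero, zero_add, smul_apply, ContinuousLinearMap.smulRight_apply] at this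
    rw [add_comm, this, add_comm]
  have d6 : ∀ u v w, dg u (f y v) w + g y (df u v) w = -(dg u v (f y w) + g y v (df u w)) :=
    fun u v w => by
      have e := ((hg.clm_apply (hf.clm_apply (ca v))).clm_apply (ca w)).unique
        (((hg.clm_apply (ca v)).clm_apply (hf.clm_apply (ca w))).neg.congr_of_eventuallyEq
          (h.mono fun y hy => hy.g_f v w))
      have := DFunLike.congr_fun e u
      simp only [add_apply, neg_apply, ContinuousLinearMap.comp_apply,
        ContinuousLinearMap.flip_apply, zero_apply, map_zero, zero_add] at this
      rw [add_comm, this, add_comm]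
  refine ⟨h0, fun u => ?_, fun u => ?_, fun u w => ?_, fun u v => ?_, fun u v w => ?_⟩
  · rw [nablaEnd_apply, nablaVec_apply, h0.f_z, map_zero, map_add]
    refine Eq.trans ?_ (d1 u)
    abel
  · rw [nablaForm_apply, nablaVec_apply, map_add, ← d2 u]
    ring
  · rw [nablaForm_apply, nablaVec_apply, map_add, add_apply, ← d3, hC, ← h0.g_z]
    ring
  · have e := d5 u v
    simp only [nablaEnd_apply, nablaForm_apply, nablaVec_apply, map_sub, map_add, h0.f_f, map_neg,
      map_smul, sub_smul, smul_add]
    linear_combination (norm := module) e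
  · have e := d6 u v w
    rw [hC, hC] at e
    simp only [nablaEnd_apply, map_sub, map_add, sub_apply, add_apply, h0.g_f] at e ⊢
    have e1 := h0.g_f v (C u w)
    linarith

variable [FiniteDimensional ℝ V]

/-- A positive bilinear form is an isomorphism with the dual space. -/
theorem exists_equiv_of_pos {g : V →L[ℝ] V →L[ℝ] ℝ} (hpos : ∀ v, v ≠ 0 → 0 < g v v) :
    ∃ e : V ≃L[ℝ] (V →L[ℝ] ℝ), (e : V →L[ℝ] V →L[ℝ] ℝ) = g := by
  have hinj : Function.Injective g := by
    refine (injective_iff_map_eq_zero g).2 fun v hv => ?_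
    by_contra h0
    have := hpos v h0
    rw [hv, zero_apply] at this
    exact this.false
  have hdim : Module.finrank ℝ V = Module.finrank ℝ (V →L[ℝ] ℝ) := by
    rw [← (LinearMap.toContinuousLinearMap (𝕜 := ℝ) (E := V) (F' := ℝ)).finrank_eq]
    exact (Subspace.dual_finrank_eq).symm
  exact ⟨(LinearEquiv.ofInjectiveOfFinrankEq (g : V →ₗ[ℝ] V →L[ℝ] ℝ) hinj
    hdim).toContinuousLinearEquiv, rfl⟩

/-- The Christoffel symbols of a metric at a point. -/
theorem exists_christoffel {g : V →L[ℝ] V →L[ℝ] ℝ} (hpos : ∀ v, v ≠ 0 → 0 < g v v)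
    (hs : ∀ v w, g v w = g w v)
    (dg : V →L[ℝ] V →L[ℝ] V →L[ℝ] ℝ) (hdg : ∀ u v w, dg u v w = dg u w v) :
    ∃ C : V →L[ℝ] V →L[ℝ] V, (∀ v w, C v w = C w v) ∧
      ∀ v a b, dg v a b = g (C v a) b + g a (C v b) := by
  obtain ⟨e, hg⟩ := exists_equiv_of_pos hpos
  have he : ∀ a b, g (e.symm a) b = a b := fun a b => by
    rw [← hg]
    exact DFunLike.congr_fun (e.apply_symm_apply a) b
  have hinj : Function.Injective g := by
    rw [← hg]
    exact e.injective
  -- Koszul formula: the Christoffel symbols of the first kind, with the last index raised by the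
  -- metric.
  let K : V →ₗ[ℝ] V →ₗ[ℝ] V := LinearMap.mk₂ ℝ
    (fun u v => e.symm ((1 / 2 : ℝ) • (dg u v + dg v u - (dg.flip u).flip v)))
    (fun u u' v => by
      rw [← map_add]
      congr 1
      ext w
      simp
      ring)
    (fun c u v => by
      rw [← map_smul]
      congr 1
      ext w
      simp
      ring)
    (fun u u' v => by
      rw [← map_add]
      congr 1
      ext w
      simp
      ring)
    (fun c u v => by
      rw [← map_smul]
      congr 1
      ext w
      simp
      ring)
  have hK : ∀ u v w, g (K u v) w = (1 / 2) * (dg u v w + dg v u w - dg w u v) := fun u v w => by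
    refine (he _ _).trans ?_
    simp
  let C : V →L[ℝ] V →L[ℝ] V := LinearMap.toContinuousLinearMap
    ((LinearMap.toContinuousLinearMap (𝕜 := ℝ) (E := V) (F' := V)).toLinearMap ∘ₗ K)
  have hC : ∀ u v, C u v = K u v := fun _ _ => rfl
  refine ⟨C, fun v w => ?_, fun v a b => ?_⟩
  · refine hinj (ContinuousLinearMap.ext fun b => ?_)
    rw [hC, hC, hK, hK, hdg b]
    ring
  · rw [hs a, hC, hC, hK, hK, hdg v b]
    ring

end Algebra

/-! ### Cosymplectic structures are the parallel ones -/

namespace AlmostContactMetric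

variable {E : Type*} [NormedAddCommGroup E] [NormedSpace ℝ E]
  {H : Type*} [TopologicalSpace H] {I : ModelWithCorners ℝ E H}
  {M : Type*} [TopologicalSpace M] [ChartedSpace H M] [IsManifold I ∞ M]
  (C : AlmostContactMetric I M)

/-- The endomorphisms `F` read in the model space. -/
def FE (x : M) : E →L[ℝ] E := C.F x
/-- The vector field `Z` read in the model space. -/
def ZE (x : M) : E := C.Z x
/-- The `1`-form `ξ` read in the model space. -/
def ξE (x : M) : E →L[ℝ] ℝ := C.ξ x
/-- The metric `γ` read in the model space. -/
def γE (x : M) : E →L[ℝ] E →L[ℝ] ℝ := C.γ.inner x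

theorem isContactAlg (x : M) : IsContactAlg (C.FE x) (C.ZE x) (C.ξE x) (C.γE x) :=
  ⟨C.γ.symm x, C.γ.pos x, C.ξ_Z x, C.F_Z x, C.ξ_F x, C.F_F x, C.compat x⟩

theorem isContactAlg_hat {x₀ : M} {y : E} (hy : y ∈ (extChartAt I x₀).target) :
    IsContactAlg (endHat I x₀ C.FE y) (vecHat I x₀ C.ZE y) (formHat I x₀ C.ξE y)
      (bilinHat I x₀ C.γE y) := by
  have h := C.isContactAlg ((extChartAt I x₀).symm y)
  refine ⟨fun v w => ?_, fun v hv => ?_, ?_, ?_, fun v => ?_, fun v => ?_, fun v w => ?_⟩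
  · exact h.symm _ _
  · refine h.pos _ fun h0 => hv ?_
    exact (coframe_frame I hy v).symm.trans ((congrArg (coframe I x₀ y) h0).trans (map_zero _))
  all_goals simp only [endHat, vecHat, formHat, bilinHat_apply, ContinuousLinearMap.comp_apply,
    frame_coframe I hy]
  · exact h.ξ_z
  · rw [h.f_z, map_zero]
  · exact h.ξ_f _
  · rw [h.f_f, map_add, map_neg, coframe_frame I hy, map_smul]
  · exact h.compat _ _

variable [I.Boundaryless]

theorem contDiffAt_FE (x₀ : M) : ContDiffAt ℝ ∞ (endHat I x₀ C.FE) (extChartAt I x₀ x₀) :=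
  SmoothEnd.contDiffAt_hat I C.smooth_F x₀

theorem contDiffAt_ZE (x₀ : M) : ContDiffAt ℝ ∞ (vecHat I x₀ C.ZE) (extChartAt I x₀ x₀) :=
  (smoothVec_iff I C.ZE).1 C.smooth_Z x₀

theorem contDiffAt_ξE (x₀ : M) : ContDiffAt ℝ ∞ (formHat I x₀ C.ξE) (extChartAt I x₀ x₀) :=
  (smoothForm_iff I C.ξE).1 C.smooth_ξ x₀

theorem contDiffAt_γE (x₀ : M) : ContDiffAt ℝ ∞ (bilinHat I x₀ C.γE) (extChartAt I x₀ x₀) :=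
  contDiffAt_bilinHat I C.γ.contMDiff x₀

/-- The differential of `F` at the center of the chart around `x₀`. -/
def dF (x₀ : M) : E →L[ℝ] E →L[ℝ] E := fderiv ℝ (endHat I x₀ C.FE) (extChartAt I x₀ x₀)
/-- The differential of `Z` at the center of the chart around `x₀`. -/
def dZ (x₀ : M) : E →L[ℝ] E := fderiv ℝ (vecHat I x₀ C.ZE) (extChartAt I x₀ x₀)
/-- The differential of the components of `ξ` at the center of the chart around `x₀`. -/
def dξ (x₀ : M) : E →L[ℝ] E →L[ℝ] ℝ := fderiv ℝ (formHat I x₀ C.ξE) (extChartAt I x₀ x₀)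
/-- The differential of `γ` at the center of the chart around `x₀`. -/
def dγ (x₀ : M) : E →L[ℝ] E →L[ℝ] E →L[ℝ] ℝ :=
  fderiv ℝ (bilinHat I x₀ C.γE) (extChartAt I x₀ x₀)

theorem hasFDerivAt_FE (x₀ : M) :
    HasFDerivAt (endHat I x₀ C.FE) (C.dF x₀) (extChartAt I x₀ x₀) :=
  ((C.contDiffAt_FE x₀).differentiableAt (by simp)).hasFDerivAt

theorem hasFDerivAt_ZE (x₀ : M) :
    HasFDerivAt (vecHat I x₀ C.ZE) (C.dZ x₀) (extChartAt I x₀ x₀) :=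
  ((C.contDiffAt_ZE x₀).differentiableAt (by simp)).hasFDerivAt

theorem hasFDerivAt_ξE (x₀ : M) :
    HasFDerivAt (formHat I x₀ C.ξE) (C.dξ x₀) (extChartAt I x₀ x₀) :=
  ((C.contDiffAt_ξE x₀).differentiableAt (by simp)).hasFDerivAt

theorem hasFDerivAt_γE (x₀ : M) :
    HasFDerivAt (bilinHat I x₀ C.γE) (C.dγ x₀) (extChartAt I x₀ x₀) :=
  ((C.contDiffAt_γE x₀).differentiableAt (by simp)).hasFDerivAt

/-- `Γ` are the Christoffel symbols of `γ` at the centers of the charts. -/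
def IsChristoffel (Γ : M → E →L[ℝ] E →L[ℝ] E) : Prop :=
  ∀ x₀, (∀ v w, Γ x₀ v w = Γ x₀ w v) ∧
    ∀ v a b, C.dγ x₀ v a b = C.γE x₀ (Γ x₀ v a) b + C.γE x₀ a (Γ x₀ v b)

/-- The symbols are chosen separately at each center, with no regularity in `x₀`, because they are
never differentiated. -/
theorem exists_isChristoffel [FiniteDimensional ℝ E] : ∃ Γ, C.IsChristoffel Γ := by
  refine Classical.axiom_of_choice fun x₀ => exists_christoffel (C.isContactAlg x₀).pos
    (C.isContactAlg x₀).symm (C.dγ x₀) fun u v w => ?_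
  have ca : ∀ a : E, HasFDerivAt (fun _ : E => a) (0 : E →L[ℝ] E) (extChartAt I x₀ x₀) :=
    fun a => hasFDerivAt_const a _
  have e := (((C.hasFDerivAt_γE x₀).clm_apply (ca v)).clm_apply (ca w)).unique
    ((((C.hasFDerivAt_γE x₀).clm_apply (ca w)).clm_apply (ca v)).congr_of_eventuallyEq
      ((eventually_mem_target I x₀).mono fun y hy => (C.isContactAlg_hat hy).symm v w))
  have := DFunLike.congr_fun e u
  simpa only [add_apply, ContinuousLinearMap.comp_apply, ContinuousLinearMap.flip_apply,
      zero_apply, map_zero, zero_add] using this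

variable {C} {Γ : M → E →L[ℝ] E →L[ℝ] E}

theorem IsChristoffel.isContactJet (hΓ : C.IsChristoffel Γ) (x₀ : M) :
    IsContactJet (C.FE x₀) (C.ZE x₀) (C.ξE x₀) (C.γE x₀) (nablaEnd (Γ x₀) (C.FE x₀) (C.dF x₀))
      (nablaVec (Γ x₀) (C.ZE x₀) (C.dZ x₀)) (nablaForm (Γ x₀) (C.ξE x₀) (C.dξ x₀)) := by
  have h := isContactJet_of_eventually (C := Γ x₀)
    ((eventually_mem_target I x₀).mono fun y hy => C.isContactAlg_hat hy)
    (C.hasFDerivAt_FE x₀) (C.hasFDerivAt_ZE x₀) (C.hasFDerivAt_ξE x₀) (C.hasFDerivAt_γE x₀)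
  rw [endHat_self, vecHat_self, formHat_self, bilinHat_self] at h
  exact h (hΓ x₀).2

/-- For a symmetric connection dξ is the antisymmetrization of ∇ξ. -/
theorem IsChristoffel.dForm_eq_zero_iff (hΓ : C.IsChristoffel Γ) (x₀ : M) :
    dForm I C.ξ x₀ = 0 ↔ ∀ u v, nablaForm (Γ x₀) (C.ξE x₀) (C.dξ x₀) u v =
      nablaForm (Γ x₀) (C.ξE x₀) (C.dξ x₀) v u := by
  have h : ∀ u v : E, dForm I C.ξ x₀ ![u, v] = C.dξ x₀ u v - C.dξ x₀ v u :=
    dForm_eq_chart I (C.hasFDerivAt_ξE x₀)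
  simp only [nablaForm_apply, (hΓ x₀).1, sub_left_inj]
  constructor
  · intro h0 u v
    have := h u v
    rw [h0] at this
    exact (sub_eq_zero.1 this.symm)
  · intro h0
    refine ContinuousAlternatingMap.ext fun (v : Fin 2 → E) => ?_
    have e : v = ![v 0, v 1] := by
      funext i
      fin_cases i <;> rfl
    exact ((congrArg (dForm I C.ξ x₀) e).trans (h (v 0) (v 1))).trans (sub_eq_zero.2 (h0 _ _))

/-- dΞ is the cyclic sum of ∇Ξ, and since γ is parallel the derivative falls on F alone. -/
theorem IsChristoffel.extD_fundamentalForm_apply (hΓ : C.IsChristoffel Γ) (x₀ : M) (u v w : E) :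
    extD I C.fundamentalForm x₀ ![u, v, w] =
      C.γE x₀ (nablaEnd (Γ x₀) (C.FE x₀) (C.dF x₀) u v) w
        + C.γE x₀ (nablaEnd (Γ x₀) (C.FE x₀) (C.dF x₀) v w) u
        + C.γE x₀ (nablaEnd (Γ x₀) (C.FE x₀) (C.dF x₀) w u) v := by
  have hd : HasFDerivAt (bilinHat I x₀ fun x => (C.γE x).comp (C.FE x))
      (((ContinuousLinearMap.compL ℝ E E (E →L[ℝ] ℝ)) (C.γE x₀)).comp (C.dF x₀)
        + ((ContinuousLinearMap.compL ℝ E E (E →L[ℝ] ℝ)).flip (C.FE x₀)).comp (C.dγ x₀))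
      (extChartAt I x₀ x₀) := by
    have h := (C.hasFDerivAt_γE x₀).clm_comp (C.hasFDerivAt_FE x₀)
    rw [endHat_self, bilinHat_self] at h
    refine h.congr_of_eventuallyEq ?_
    filter_upwards [eventually_mem_target I x₀] with y hy
    ext v w
    simp only [bilinHat_apply, ContinuousLinearMap.comp_apply, endHat, frame_coframe I hy]
  have h : extD I C.fundamentalForm x₀ ![u, v, w] = _ :=
    extD_two_eq_chart I hd (η := C.fundamentalForm) (fun _ _ => rfl) (fun x v w => by
      have h := C.isContactAlg x
      rw [ContinuousLinearMap.comp_apply, ContinuousLinearMap.comp_apply, h.g_f, h.symm]) u v w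
  rw [h]
  have ha := C.isContactAlg x₀
  simp only [add_apply, ContinuousLinearMap.comp_apply, ContinuousLinearMap.compL_apply,
    ContinuousLinearMap.flip_apply, (hΓ x₀).2, nablaEnd_apply, map_add, map_sub, sub_apply, ha.g_f]
  have q : ∀ a b, C.γE x₀ a (C.FE x₀ b) = -C.γE x₀ b (C.FE x₀ a) := fun a b => by
    rw [ha.symm, ha.g_f]
  rw [(hΓ x₀).1 u w, (hΓ x₀).1 v u, (hΓ x₀).1 w v]
  linarith [q v (Γ x₀ w u), q w (Γ x₀ u v), q u (Γ x₀ v w)]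

theorem IsChristoffel.extD_fundamentalForm_eq_zero_iff (hΓ : C.IsChristoffel Γ) (x₀ : M) :
    extD I C.fundamentalForm x₀ = 0 ↔ ∀ u v w,
      C.γE x₀ (nablaEnd (Γ x₀) (C.FE x₀) (C.dF x₀) u v) w
        + C.γE x₀ (nablaEnd (Γ x₀) (C.FE x₀) (C.dF x₀) v w) u
        + C.γE x₀ (nablaEnd (Γ x₀) (C.FE x₀) (C.dF x₀) w u) v = 0 := by
  have h := hΓ.extD_fundamentalForm_apply x₀
  constructor
  · intro h0 u v w
    rw [← h, h0]
    rfl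
  · intro h0
    refine ContinuousAlternatingMap.ext fun (v : Fin 3 → E) => ?_
    have e : v = ![v 0, v 1, v 2] := by
      funext i
      fin_cases i <;> rfl
    exact ((congrArg (extD I C.fundamentalForm x₀) e).trans (h _ _ _)).trans (h0 _ _ _)

/-- The Lie bracket of vector fields read in the model space. -/
def bracketE (I : ModelWithCorners ℝ E H) (X Y : M → E) (x : M) : E :=
  VectorField.mlieBracket (M := M) I X Y x

/-- The Nijenhuis tensor of `F` read in the model space. -/
def nijenhuisE (C : AlmostContactMetric I M) (X Y : M → E) (x : M) : E :=
  bracketE I (fun y => C.FE y (X y)) (fun y => C.FE y (Y y)) x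
    - C.FE x (bracketE I (fun y => C.FE y (X y)) Y x)
    - C.FE x (bracketE I X (fun y => C.FE y (Y y)) x)
    + C.FE x (C.FE x (bracketE I X Y x))

/-- The derivatives of X and Y cancel, and the symmetric Γ completes those of F to covariant ones.
Hence the Nijenhuis tensor depends on X and Y only through their values. -/
theorem IsChristoffel.nijenhuisE_eq (hΓ : C.IsChristoffel Γ) {X Y : M → E}
    (hX : SmoothVec I (M := M) X) (hY : SmoothVec I (M := M) Y) (x₀ : M) :
    C.nijenhuisE X Y x₀ = nablaEnd (Γ x₀) (C.FE x₀) (C.dF x₀) (C.FE x₀ (X x₀)) (Y x₀)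
      - nablaEnd (Γ x₀) (C.FE x₀) (C.dF x₀) (C.FE x₀ (Y x₀)) (X x₀)
      - C.FE x₀ (nablaEnd (Γ x₀) (C.FE x₀) (C.dF x₀) (X x₀) (Y x₀))
      + C.FE x₀ (nablaEnd (Γ x₀) (C.FE x₀) (C.dF x₀) (Y x₀) (X x₀)) := by
  have d : ∀ {X : M → E}, SmoothVec I (M := M) X → ∃ dX : E →L[ℝ] E, HasFDerivAt (vecHat I x₀ X) dX
      (extChartAt I x₀ x₀) ∧ ∃ dFX : E →L[ℝ] E, HasFDerivAt (vecHat I x₀ fun x => C.FE x (X x)) dFX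
        (extChartAt I x₀ x₀) ∧ ∀ u, dFX u = C.FE x₀ (dX u) + C.dF x₀ u (X x₀) := by
    intro X hX
    have h := ((((smoothVec_iff I X).1 hX) x₀).differentiableAt (by simp)).hasFDerivAt
    refine ⟨_, h, _, ((C.hasFDerivAt_FE x₀).clm_apply h).congr_of_eventuallyEq ?_, fun u => ?_⟩
    · filter_upwards [eventually_mem_target I x₀] with y hy
      simp only [endHat, vecHat, ContinuousLinearMap.comp_apply, frame_coframe I hy]
    · rw [endHat_self, vecHat_self]
      rfl
  obtain ⟨dX, hX, dFX, hFX, eX⟩ := d hX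
  obtain ⟨dY, hY, dFY, hFY, eY⟩ := d hY
  have b : ∀ {X Y : M → E} {dX dY : E →L[ℝ] E},
      HasFDerivAt (vecHat I x₀ X) dX (extChartAt I x₀ x₀) →
      HasFDerivAt (vecHat I x₀ Y) dY (extChartAt I x₀ x₀) →
      bracketE I X Y x₀ = dY (X x₀) - dX (Y x₀) := mlieBracket_eq_chart I
  rw [nijenhuisE, b hX hY, b hFX hY, b hX hFY, b hFX hFY]
  simp only [eX, eY, nablaEnd_apply, map_sub, map_add]
  rw [(hΓ x₀).1 (X x₀) (Y x₀), (hΓ x₀).1 (C.FE x₀ (X x₀)) (Y x₀),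
    (hΓ x₀).1 (C.FE x₀ (Y x₀)) (X x₀), (hΓ x₀).1 (C.FE x₀ (X x₀)) (C.FE x₀ (Y x₀))]
  abel

/-- Once dξ = 0 normality says that the Nijenhuis tensor vanishes; arbitrary vectors at a point
extend to global smooth fields. -/
theorem IsChristoffel.isNormal_iff [FiniteDimensional ℝ E] [T2Space M] (hΓ : C.IsChristoffel Γ)
    (h : ∀ x, dForm I C.ξ x = 0) :
    C.IsNormal ↔ ∀ x₀ u v, nablaEnd (Γ x₀) (C.FE x₀) (C.dF x₀) (C.FE x₀ u) v
      - nablaEnd (Γ x₀) (C.FE x₀) (C.dF x₀) (C.FE x₀ v) u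
      - C.FE x₀ (nablaEnd (Γ x₀) (C.FE x₀) (C.dF x₀) u v)
      + C.FE x₀ (nablaEnd (Γ x₀) (C.FE x₀) (C.dF x₀) v u) = 0 := by
  have e : ∀ (X Y : M → E) x, -(dForm I C.ξ x ![X x, Y x]) • C.ZE x = 0 := fun X Y x => by
    rw [h]
    exact (congrArg (fun r => -r • C.ZE x) rfl).trans ((congrArg (· • C.ZE x) neg_zero).trans
      (zero_smul ℝ _))
  have e' : C.IsNormal ↔ ∀ X Y : M → E, SmoothVec I (M := M) X → SmoothVec I (M := M) Y → ∀ x,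
      C.nijenhuisE X Y x = 0 :=
    forall_congr' fun X => forall_congr' fun Y => forall_congr' fun hX => forall_congr' fun hY =>
      forall_congr' fun x => by
        rw [← e X Y x]
        rfl
  rw [e']
  constructor
  · intro h x₀ u v
    obtain ⟨X, hX, rfl⟩ := exists_smoothVec_eq I x₀ u
    obtain ⟨Y, hY, rfl⟩ := exists_smoothVec_eq I x₀ v
    rw [← hΓ.nijenhuisE_eq hX hY]
    exact h X Y hX hY x₀
  · intro h X Y hX hY x
    rw [hΓ.nijenhuisE_eq hX hY]
    exact h _ _ _

/-- An almost contact metric structure is cosymplectic in the sense of Blair if and only if it is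
parallel for the Levi-Civita connection. -/
theorem IsChristoffel.isCosymplectic_iff [FiniteDimensional ℝ E] [T2Space M]
    (hΓ : C.IsChristoffel Γ) : C.IsCosymplectic ↔ ∀ x₀, nablaEnd (Γ x₀) (C.FE x₀) (C.dF x₀) = 0 ∧
      nablaVec (Γ x₀) (C.ZE x₀) (C.dZ x₀) = 0 ∧ nablaForm (Γ x₀) (C.ξE x₀) (C.dξ x₀) = 0 := by
  refine Iff.trans ?_ (forall_congr' fun x₀ => (hΓ.isContactJet x₀).isBlairJet_iff)
  constructor
  · rintro ⟨h1, h2, h3⟩ x₀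
    exact ⟨(hΓ.dForm_eq_zero_iff x₀).1 (h2 x₀), (hΓ.extD_fundamentalForm_eq_zero_iff x₀).1 (h3 x₀),
      (hΓ.isNormal_iff h2).1 h1 x₀⟩
  · intro h
    have h2 := fun x₀ => (hΓ.dForm_eq_zero_iff x₀).2 (h x₀).symm
    exact ⟨(hΓ.isNormal_iff h2).2 fun x₀ => (h x₀).nijenhuis, h2,
      fun x₀ => (hΓ.extD_fundamentalForm_eq_zero_iff x₀).2 (h x₀).cyclic⟩

end AlmostContactMetric

/-! ### The generalized metric of a scalar product -/

section Sharp

variable {V : Type*} [NormedAddCommGroup V] [NormedSpace ℝ V]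

/-- A scalar product. -/
structure IsScalarProd (g : V →L[ℝ] V →L[ℝ] ℝ) : Prop where
  symm : ∀ v w, g v w = g w v
  pos : ∀ v, v ≠ 0 → 0 < g v v

/-- The endomorphism `(v, α) ↦ (g⁻¹ α, g v)`. -/
def sharp (g : V →L[ℝ] V →L[ℝ] ℝ) : Big V →L[ℝ] Big V :=
  (g.inverse.comp (ContinuousLinearMap.snd ℝ _ _)).prod (g.comp (ContinuousLinearMap.fst ℝ _ _))

theorem sharp_apply (g : V →L[ℝ] V →L[ℝ] ℝ) (a : Big V) : sharp g a = (g.inverse a.2, g a.1) := rfl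

namespace IsScalarProd

variable [FiniteDimensional ℝ V] {g : V →L[ℝ] V →L[ℝ] ℝ} (h : IsScalarProd g)
include h

theorem apply_inverse (α : V →L[ℝ] ℝ) : g (g.inverse α) = α := by
  obtain ⟨e, rfl⟩ := exists_equiv_of_pos h.pos
  rw [ContinuousLinearMap.inverse_equiv]
  exact e.apply_symm_apply α

theorem inverse_apply (v : V) : g.inverse (g v) = v := by
  obtain ⟨e, rfl⟩ := exists_equiv_of_pos h.pos
  rw [ContinuousLinearMap.inverse_equiv]
  exact e.symm_apply_apply v

theorem sharp_sharp (a : Big V) : sharp g (sharp g a) = a :=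
  Prod.ext (h.inverse_apply _) (h.apply_inverse _)

theorem pair_sharp_sharp (a b : Big V) : pair (sharp g a) (sharp g b) = pair a b := by
  simp only [pair, sharp_apply]
  rw [h.symm, h.apply_inverse, h.symm b.1, h.apply_inverse]
  ring

theorem pair_sharp_pos {a : Big V} (ha : a ≠ 0) : 0 < 2 * pair (sharp g a) a := by
  have e : 2 * pair (sharp g a) a = g a.1 a.1 + g (g.inverse a.2) (g.inverse a.2) := by
    simp only [pair, sharp_apply]
    rw [h.apply_inverse]
    ring
  have nn : ∀ v, 0 ≤ g v v := fun v => by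
    by_cases hv : v = 0
    · simp [hv]
    · exact (h.pos v hv).le
  rw [e]
  by_cases h1 : a.1 = 0
  · refine add_pos_of_nonneg_of_pos (nn _) (h.pos _ fun h2 => ha (Prod.ext h1 ?_))
    rw [← h.apply_inverse a.2, h2, map_zero]
    rfl
  · exact add_pos_of_pos_of_nonneg (h.pos _ h1) (nn _)

/-- The eigenspaces are the graphs of `g` and `-g`, which project onto `V`. -/
theorem exists_sharp_eq (ε : ℝ) (hε : ε = 1 ∨ ε = -1) (v : V) :
    ∃ w : Big V, sharp g w = ε • w ∧ w.1 = v := by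
  refine ⟨(v, ε • g v), Prod.ext ?_ ?_, rfl⟩
  · simp only [sharp_apply, map_smul, h.inverse_apply]
    rfl
  · have : ε * ε = 1 := by rcases hε with rfl | rfl <;> norm_num
    change g v = ε • ε • g v
    rw [smul_smul, this, one_smul]

theorem contDiffAt_sharp : ContDiffAt ℝ ∞ (sharp (V := V)) g := by
  have hi : ContDiffAt ℝ ∞ (ContinuousLinearMap.inverse (M := V) (M₂ := V →L[ℝ] ℝ)
      (R := ℝ)) g := by
    obtain ⟨e, rfl⟩ := exists_equiv_of_pos h.pos
    have : CompleteSpace V := FiniteDimensional.complete ℝ V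
    exact contDiffAt_map_inverse e
  have h1 := hi.clm_comp (contDiffAt_const (c := ContinuousLinearMap.snd ℝ V (V →L[ℝ] ℝ)))
  have h2 := contDiffAt_id.clm_comp (𝕜 := ℝ) (n := ∞) (x := g)
    (contDiffAt_const (c := ContinuousLinearMap.fst ℝ V (V →L[ℝ] ℝ)))
  have h3 := ((contDiffAt_const (c := ContinuousLinearMap.inl ℝ V (V →L[ℝ] ℝ))).clm_comp h1).add
    ((contDiffAt_const (c := ContinuousLinearMap.inr ℝ V (V →L[ℝ] ℝ))).clm_comp h2)
  refine h3.congr_of_eventuallyEq (.of_forall fun g => ContinuousLinearMap.ext fun a => ?_)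
  exact Prod.ext (add_zero _).symm (zero_add _).symm

omit h in
theorem _root_.ContDiffAt.sharp {b : V → V →L[ℝ] V →L[ℝ] ℝ} {y : V} (hb : ContDiffAt ℝ ∞ b y)
    (h : IsScalarProd (b y)) : ContDiffAt ℝ ∞ (fun y => sharp (b y)) y :=
  h.contDiffAt_sharp.comp y hb

end IsScalarProd

/-- The endomorphism `sharp g` is parallel for a metric connection. -/
theorem nablaBig_sharp_eq_zero [FiniteDimensional ℝ V] {g : V → V →L[ℝ] V →L[ℝ] ℝ}
    {dg : V →L[ℝ] V →L[ℝ] V →L[ℝ] ℝ} {y : V} (h : ∀ᶠ y in 𝓝 y, IsScalarProd (g y))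
    (hg : HasFDerivAt g dg y) {C : V →L[ℝ] V →L[ℝ] V}
    (hC : ∀ v a b, dg v a b = g y (C v a) b + g y a (C v b)) {dS : V →L[ℝ] Big V →L[ℝ] Big V}
    (hS : HasFDerivAt (fun y => sharp (g y)) dS y) (v : V) :
    nablaBig C (sharp (g y)) dS v = 0 := by
  have h0 := h.self_of_nhds
  have hC' : ∀ a, dg v a = g y (C v a) + (g y a).comp (C v) := fun a =>
    ContinuousLinearMap.ext fun b => hC v a b
  have ca' : ∀ {a : V}, HasFDerivAt (fun _ : V => a) (0 : V →L[ℝ] V) y :=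
    fun {a} => hasFDerivAt_const a y
  -- Differentiating (a, 0) ↦ (0, g a) and (0, g a) ↦ (a, 0) determines `dS` without differentiating
  -- the inverse of g. The two kinds of argument span, because every covector is some g b.
  have d1 : ∀ a, dS v (a, 0) = (0, dg v a) := fun a => by
    have ca : HasFDerivAt (fun _ : V => ((a, 0) : Big V)) (0 : V →L[ℝ] Big V) y :=
      hasFDerivAt_const _ y
    have e := (hS.clm_apply ca).unique (((hasFDerivAt_const (0 : V) y).prodMk
      (hg.clm_apply ca')).congr_of_eventuallyEq
        (.of_forall fun y => Prod.ext (map_zero (g y).inverse) rfl))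
    have := DFunLike.congr_fun e v
    simpa using this
  have d2 : ∀ a, dS v (0, g y a) + sharp (g y) (0, dg v a) = 0 := fun a => by
    have ca := (hasFDerivAt_const (0 : V) y).prodMk (hg.clm_apply (ca' (a := a)))
    have e := (hS.clm_apply ca).unique ((hasFDerivAt_const ((a, 0) : Big V) y).congr_of_eventuallyEq
      (h.mono fun y hy => Prod.ext (hy.inverse_apply a) (map_zero (g y))))
    have := DFunLike.congr_fun e v
    rw [add_comm]
    simpa using this
  refine ContinuousLinearMap.ext fun a => ?_
  obtain ⟨b, hb⟩ : ∃ b, a.2 = g y b := ⟨_, (h0.apply_inverse a.2).symm⟩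
  have ea : a = (a.1, 0) + (0, g y b) := Prod.ext (by simp) (by simp [hb])
  have e1 := d1 a.1
  have e2 := eq_neg_of_add_eq_zero_left (d2 b)
  rw [ea, map_add, nablaBig_apply, nablaBig_apply, e1, e2]
  refine Prod.ext ?_ ?_
  · simp [sharp_apply, bigAct, hC', h0.inverse_apply]
  · simp [sharp_apply, bigAct, hC', h0.inverse_apply]

end Sharp

/-! ### Generalized Riemannian metrics from Riemannian ones -/

section Manifold

variable {E : Type*} [NormedAddCommGroup E] [NormedSpace ℝ E]
  {H : Type*} [TopologicalSpace H] (I : ModelWithCorners ℝ E H)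
  {M : Type*} [TopologicalSpace M] [ChartedSpace H M] [IsManifold I ∞ M]
  {g : M → E →L[ℝ] E →L[ℝ] ℝ}

theorem IsScalarProd.hat (hg : ∀ x, IsScalarProd (g x)) {x₀ : M} {y : E}
    (hy : y ∈ (extChartAt I x₀).target) : IsScalarProd (bilinHat I x₀ g y) := by
  refine ⟨fun v w => (hg _).symm _ _, fun v hv => (hg _).pos _ fun h0 => hv ?_⟩
  exact (coframe_frame I hy v).symm.trans ((congrArg (coframe I x₀ y) h0).trans (map_zero _))

variable [I.Boundaryless] [FiniteDimensional ℝ E]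

theorem isChartRep_sharp (hg : ∀ x, IsScalarProd (g x)) (x₀ : M) :
    IsChartRep I x₀ (fun x => sharp (V := E) (g x)) (fun y => sharp (bilinHat I x₀ g y)) := by
  filter_upwards [eventually_mem_target I x₀] with y hy s
  have h := hg ((extChartAt I x₀).symm y)
  have h' := IsScalarProd.hat I hg hy
  refine Prod.ext ?_ (ContinuousLinearMap.ext fun w => ?_)
  -- The vector components are compared after lowering the index, which avoids conjugating the
  -- inverse metric by frames.
  · refine (h'.inverse_apply _).symm.trans (congrArg _ (ContinuousLinearMap.ext fun w => ?_))
    rw [bilinHat_apply]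
    refine (congrArg (fun u => g _ u (frame I x₀ y w)) (frame_coframe I hy _)).trans ?_
    exact DFunLike.congr_fun (h.apply_inverse _) (frame I x₀ y w)
  · exact congrArg (fun u => g ((extChartAt I x₀).symm y) u (frame I x₀ y w))
      (frame_coframe I hy (s ((extChartAt I x₀).symm y)).1).symm

theorem isGenRiemannianMetric_sharp (hg : ∀ x, IsScalarProd (g x))
    (hs : ∀ x₀, ContDiffAt ℝ ∞ (bilinHat I x₀ g) (extChartAt I x₀ x₀)) :
    IsGenRiemannianMetric I (M := M) (fun x => sharp (V := E) (g x)) := by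
  have hsm : SmoothBigEnd I (M := M) (fun x => sharp (V := E) (g x)) :=
    smoothBigEnd_of_chartRep I (Φ := fun x => sharp (V := E) (g x)) fun x₀ =>
      ⟨_, isChartRep_sharp I hg x₀, (hs x₀).sharp (IsScalarProd.hat I hg (mem_extChartAt_target x₀))⟩
  have hpos : ∀ x (a : Big E), a ≠ 0 → 0 < 2 * pair (sharp (g x) a) a :=
    fun x a ha => (hg x).pair_sharp_pos ha
  exact ⟨hsm, fun x => (hg x).sharp_sharp, fun x => (hg x).pair_sharp_sharp, hpos⟩

end Manifold

/-! ### The fiberwise model of Φ₀ on V × ℝ -/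

section Model

variable {V : Type*} [NormedAddCommGroup V] [NormedSpace ℝ V]

/-- The model of `Φ₀` on `V × ℝ`. -/
def phiModel (f : V →L[ℝ] V) (z : V) (ξ : V →L[ℝ] ℝ) : Big (V × ℝ) →L[ℝ] Big (V × ℝ) :=
  let A : V × ℝ →L[ℝ] V × ℝ := (ContinuousLinearMap.inl ℝ V ℝ).comp
    (f.comp (ContinuousLinearMap.fst ℝ V ℝ))
  (A.coprod ((ContinuousLinearMap.apply ℝ ℝ (z, (0 : ℝ))).smulRight ((0 : V), (1 : ℝ))
      - (ContinuousLinearMap.apply ℝ ℝ ((0 : V), (1 : ℝ))).smulRight (z, (0 : ℝ)))).prod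
    (((ξ.comp (ContinuousLinearMap.fst ℝ V ℝ)).smulRight (ContinuousLinearMap.snd ℝ V ℝ)
      - (ContinuousLinearMap.snd ℝ V ℝ).smulRight (ξ.comp (ContinuousLinearMap.fst ℝ V ℝ))).coprod
        (-(ContinuousLinearMap.precomp ℝ A)))

theorem phiModel_fst (f : V →L[ℝ] V) (z : V) (ξ : V →L[ℝ] ℝ) (a : Big (V × ℝ)) :
    (phiModel f z ξ a).1 = (f a.1.1 - a.2 (0, 1) • z, a.2 (z, 0)) := by
  simp [phiModel, sub_eq_add_neg]

theorem phiModel_snd (f : V →L[ℝ] V) (z : V) (ξ : V →L[ℝ] ℝ) (a : Big (V × ℝ)) (w : V × ℝ) :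
    (phiModel f z ξ a).2 w = ξ a.1.1 * w.2 - a.1.2 * ξ w.1 - a.2 (f w.1, 0) := by
  simp [phiModel, sub_eq_add_neg]

theorem pair_phiModel (f : V →L[ℝ] V) (z : V) (ξ : V →L[ℝ] ℝ) (a b : Big (V × ℝ)) :
    pair (phiModel f z ξ a) b = -pair a (phiModel f z ξ b) := by
  have e : ∀ (α : V × ℝ →L[ℝ] ℝ) (v : V) (s : ℝ), α (v, s) = α (v, 0) + s * α (0, 1) :=
    fun α v s => by
      rw [← smul_eq_mul, ← map_smul, ← map_add]
      simp
  simp only [pair, phiModel_fst, phiModel_snd]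
  have h1 : ∀ (α : V × ℝ →L[ℝ] ℝ) (v : V) (r s : ℝ), α (v - r • z, s) =
      α (v, 0) - r * α (z, 0) + s * α (0, 1) := fun α v r s => by
    rw [e, ← smul_eq_mul r, ← map_smul, ← map_sub]
    simp
  rw [h1, h1]
  ring

theorem phiModel_phiModel {f : V →L[ℝ] V} {z : V} {ξ : V →L[ℝ] ℝ} {g : V →L[ℝ] V →L[ℝ] ℝ}
    (h : IsContactAlg f z ξ g) (a : Big (V × ℝ)) : phiModel f z ξ (phiModel f z ξ a) = -a := by
  refine Prod.ext (Prod.ext ?_ ?_) (ContinuousLinearMap.ext fun w => ?_)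
  · simp only [phiModel_fst, phiModel_snd, map_sub, map_smul, h.f_z, h.f_f, map_zero, Prod.fst_neg]
    have : a.2 ((0 : V), (0 : ℝ)) = 0 := map_zero a.2
    simp [this]
  · simp only [phiModel_fst, phiModel_snd, h.f_z, h.ξ_z, Prod.snd_neg, Prod.fst_neg]
    have : a.2 ((0 : V), (0 : ℝ)) = 0 := map_zero a.2
    simp [this]
  · simp only [phiModel_fst, phiModel_snd, map_sub, map_smul, h.ξ_f, h.f_f, h.ξ_z, Prod.snd_neg,
      neg_apply]
    have : a.2 w = a.2 (w.1, 0) + w.2 * a.2 (0, 1) := by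
      rw [← smul_eq_mul, ← map_smul, ← map_add]
      simp
    have h2 : a.2 (-w.1 + ξ w.1 • z, 0) = -a.2 (w.1, 0) + ξ w.1 * a.2 (z, 0) := by
      rw [← smul_eq_mul, ← map_smul, ← map_neg, ← map_add]
      simp
    rw [h2, this]
    simp only [smul_eq_mul]
    ring

/-- The metric `g + dt²` on `V × ℝ`. -/
def prodBilin (g : V →L[ℝ] V →L[ℝ] ℝ) : V × ℝ →L[ℝ] V × ℝ →L[ℝ] ℝ :=
  (ContinuousLinearMap.precomp ℝ (ContinuousLinearMap.fst ℝ V ℝ)).comp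
    (g.comp (ContinuousLinearMap.fst ℝ V ℝ))
    + (ContinuousLinearMap.snd ℝ V ℝ).smulRight (ContinuousLinearMap.snd ℝ V ℝ)

theorem prodBilin_apply (g : V →L[ℝ] V →L[ℝ] ℝ) (v w : V × ℝ) :
    prodBilin g v w = g v.1 w.1 + v.2 * w.2 := rfl

theorem IsScalarProd.prodBilin {g : V →L[ℝ] V →L[ℝ] ℝ} (h : IsScalarProd g) :
    IsScalarProd (prodBilin g) := by
  refine ⟨fun v w => ?_, fun v hv => ?_⟩
  · rw [prodBilin_apply, prodBilin_apply, h.symm, mul_comm]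
  · rw [prodBilin_apply]
    by_cases h1 : v.1 = 0
    · have h2 : v.2 ≠ 0 := fun h2 => hv (Prod.ext h1 h2)
      have := mul_self_pos.2 h2
      simpa [h1] using this
    · exact add_pos_of_pos_of_nonneg (h.pos _ h1) (mul_self_nonneg _)

theorem _root_.ContDiffAt.prodBilin {W : Type*} [NormedAddCommGroup W] [NormedSpace ℝ W]
    {g : W → V →L[ℝ] V →L[ℝ] ℝ} {y : W} (hg : ContDiffAt ℝ ∞ g y) :
    ContDiffAt ℝ ∞ (fun y => prodBilin (g y)) y :=
  (contDiffAt_const.clm_comp (hg.clm_comp contDiffAt_const)).add contDiffAt_const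

theorem _root_.HasFDerivAt.prodBilin {W : Type*} [NormedAddCommGroup W] [NormedSpace ℝ W]
    {g : W → V →L[ℝ] V →L[ℝ] ℝ} {y : W} {dg : W →L[ℝ] V →L[ℝ] V →L[ℝ] ℝ}
    (hg : HasFDerivAt g dg y) : ∃ D : W →L[ℝ] V × ℝ →L[ℝ] V × ℝ →L[ℝ] ℝ,
      HasFDerivAt (fun y => prodBilin (g y)) D y ∧ ∀ w a b, D w a b = dg w a.1 b.1 := by
  have h1 := hg.clm_comp (hasFDerivAt_const (ContinuousLinearMap.fst ℝ V ℝ) y)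
  have h2 := (hasFDerivAt_const (ContinuousLinearMap.precomp ℝ (ContinuousLinearMap.fst ℝ V ℝ))
    y).clm_comp h1
  have h3 := h2.add (hasFDerivAt_const
    ((ContinuousLinearMap.snd ℝ V ℝ).smulRight (ContinuousLinearMap.snd ℝ V ℝ)) y)
  refine ⟨_, h3, fun w a b => ?_⟩
  simp

theorem sharp_phiModel [FiniteDimensional ℝ V] {f : V →L[ℝ] V} {z : V} {ξ : V →L[ℝ] ℝ}
    {g : V →L[ℝ] V →L[ℝ] ℝ} (h : IsContactAlg f z ξ g) (a : Big (V × ℝ)) :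
    sharp (prodBilin g) (phiModel f z ξ a) = phiModel f z ξ (sharp (prodBilin g) a) := by
  have hg : IsScalarProd (prodBilin g) := IsScalarProd.prodBilin ⟨h.symm, h.pos⟩
  -- After identifying covectors with vectors, `sharp` swaps the two components. This identity
  -- expresses the commutation; it encodes that f is skew and that ξ is dual to z, and yields both
  -- components.
  have key : ∀ v w : V × ℝ, prodBilin g (phiModel f z ξ (v, prodBilin g w)).1 =
      (phiModel f z ξ (w, prodBilin g v)).2 := fun v w => by
    refine ContinuousLinearMap.ext fun u => ?_
    simp only [phiModel_fst, phiModel_snd, prodBilin_apply, map_sub, map_smul, sub_apply,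
      smul_apply, map_zero, h.g_z, h.g_z_right, h.g_f, smul_eq_mul]
    ring
  obtain ⟨w, hw⟩ : ∃ w, a.2 = prodBilin g w := ⟨_, (hg.apply_inverse a.2).symm⟩
  have ea : a = (a.1, prodBilin g w) := Prod.ext rfl hw
  have es : ∀ v w, sharp (prodBilin g) (v, prodBilin g w) = (w, prodBilin g v) := fun v w =>
    Prod.ext (hg.inverse_apply w) rfl
  rw [ea, es]
  refine Prod.ext ?_ (key _ _)
  rw [sharp_apply, ← key]
  exact hg.inverse_apply _

/-- The product of a connection with the trivial connection of `ℝ`. -/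
def prodConn (C : V →L[ℝ] V →L[ℝ] V) : V × ℝ →L[ℝ] V × ℝ →L[ℝ] V × ℝ :=
  ((ContinuousLinearMap.compL ℝ (V × ℝ) V (V × ℝ)) (ContinuousLinearMap.inl ℝ V ℝ)).comp
    (((ContinuousLinearMap.compL ℝ (V × ℝ) V V).flip (ContinuousLinearMap.fst ℝ V ℝ)).comp
      (C.comp (ContinuousLinearMap.fst ℝ V ℝ)))

theorem prodConn_apply (C : V →L[ℝ] V →L[ℝ] V) (v w : V × ℝ) :
    prodConn C v w = (C v.1 w.1, 0) := rfl

/-- The model is built linearly from (f, z, ξ) and from ∂/∂t and dt, which are parallel for the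
product connection. -/
theorem nablaBig_phiModel (C : V →L[ℝ] V →L[ℝ] V) (f : V →L[ℝ] V) (z : V) (ξ : V →L[ℝ] ℝ)
    (df : V →L[ℝ] V →L[ℝ] V) (dz : V →L[ℝ] V) (dξ : V →L[ℝ] V →L[ℝ] ℝ)
    {dΦ : V × ℝ →L[ℝ] Big (V × ℝ) →L[ℝ] Big (V × ℝ)}
    (hd : ∀ v, dΦ v = phiModel (df v.1) (dz v.1) (dξ v.1)) (v : V × ℝ) :
    nablaBig (prodConn C) (phiModel f z ξ) dΦ v =
      phiModel (nablaEnd C f df v.1) (nablaVec C z dz v.1) (nablaForm C ξ dξ v.1) := by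
  refine ContinuousLinearMap.ext fun a => ?_
  rw [nablaBig_apply (V := V × ℝ), hd]
  have e0 : ∀ α : V × ℝ →L[ℝ] ℝ, α ((0 : V), (0 : ℝ)) = 0 := fun α => map_zero α
  refine Prod.ext (Prod.ext ?_ ?_) (ContinuousLinearMap.ext fun w => ?_)
  · simp only [bigAct, prodConn_apply, phiModel_fst, nablaEnd_apply, nablaVec_apply,
      Prod.fst_add, Prod.fst_sub, map_sub, map_smul, neg_apply, ContinuousLinearMap.comp_apply,
      map_zero, smul_add, e0, neg_zero, zero_smul, sub_zero]
    abel
  · simp only [bigAct, prodConn_apply, phiModel_fst, nablaEnd_apply, nablaVec_apply,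
      Prod.fst_add, Prod.fst_sub, Prod.snd_add, Prod.snd_sub, neg_apply,
      ContinuousLinearMap.comp_apply, add_zero, sub_neg_eq_add]
    rw [← map_add]
    simp
  · simp only [bigAct, prodConn_apply, phiModel_fst, phiModel_snd, nablaEnd_apply, nablaForm_apply,
      Prod.snd_add, Prod.snd_sub, add_apply, sub_apply, neg_apply,
      ContinuousLinearMap.comp_apply]
    have e1 : a.2 (df v.1 w.1 + C v.1 (f w.1) - f (C v.1 w.1), 0) =
        a.2 (df v.1 w.1, 0) + a.2 (C v.1 (f w.1), 0) - a.2 (f (C v.1 w.1), 0) := by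
      rw [← map_add, ← map_sub]
      simp
    rw [e1]
    ring

/-- Joint linearity in the triple; smoothness and differentials of Φ₀ are obtained from it through
`linear_comp`. -/
theorem phiModel_add (p q : (V →L[ℝ] V) × V × (V →L[ℝ] ℝ)) :
    phiModel (p + q).1 (p + q).2.1 (p + q).2.2 =
      phiModel p.1 p.2.1 p.2.2 + phiModel q.1 q.2.1 q.2.2 := by
  refine ContinuousLinearMap.ext fun a =>
    Prod.ext (Prod.ext ?_ ?_) (ContinuousLinearMap.ext fun w => ?_)
  · rw [add_apply, Prod.fst_add, Prod.fst_add, phiModel_fst, phiModel_fst, phiModel_fst]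
    simp only [Prod.fst_add, Prod.snd_add, add_apply, smul_add]
    abel
  · simp only [add_apply, phiModel_fst, Prod.fst_add, Prod.snd_add]
    rw [← map_add]
    simp
  · have : a.2 ((p + q).1 w.1, 0) = a.2 (p.1 w.1, 0) + a.2 (q.1 w.1, 0) := by
      rw [← map_add]
      simp
    simp only [add_apply, Prod.snd_add, phiModel_snd, this]
    ring

theorem phiModel_smul (c : ℝ) (p : (V →L[ℝ] V) × V × (V →L[ℝ] ℝ)) :
    phiModel (c • p).1 (c • p).2.1 (c • p).2.2 = c • phiModel p.1 p.2.1 p.2.2 := by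
  refine ContinuousLinearMap.ext fun a =>
    Prod.ext (Prod.ext ?_ ?_) (ContinuousLinearMap.ext fun w => ?_)
  · rw [smul_apply, Prod.smul_fst, Prod.smul_fst, phiModel_fst, phiModel_fst]
    simp only [Prod.smul_fst, Prod.smul_snd, smul_apply, smul_sub]
    rw [smul_comm]
  · simp only [smul_apply, phiModel_fst, Prod.smul_fst, Prod.smul_snd]
    rw [← map_smul]
    simp
  · have : a.2 ((c • p).1 w.1, 0) = c * a.2 (p.1 w.1, 0) := by
      rw [← smul_eq_mul, ← map_smul]
      simp
    simp only [smul_apply, Prod.smul_snd, phiModel_snd, this, smul_eq_mul]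
    ring

section Linear

variable {W A F : Type*} [NormedAddCommGroup W] [NormedSpace ℝ W] [NormedAddCommGroup A]
  [NormedSpace ℝ A] [FiniteDimensional ℝ A] [NormedAddCommGroup F] [NormedSpace ℝ F]
  {T : A → F} {f : W → A} {y : W}

theorem _root_.ContDiffAt.linear_comp (hf : ContDiffAt ℝ ∞ f y)
    (hadd : ∀ a b, T (a + b) = T a + T b) (hsmul : ∀ (c : ℝ) a, T (c • a) = c • T a) :
    ContDiffAt ℝ ∞ (fun y => T (f y)) y :=
  (LinearMap.toContinuousLinearMap (⟨⟨T, hadd⟩, hsmul⟩ : A →ₗ[ℝ] F)).contDiff.contDiffAt.comp y hf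

theorem _root_.HasFDerivAt.linear_comp {df : W →L[ℝ] A} (hf : HasFDerivAt f df y)
    (hadd : ∀ a b, T (a + b) = T a + T b) (hsmul : ∀ (c : ℝ) a, T (c • a) = c • T a) :
    ∃ D : W →L[ℝ] F, HasFDerivAt (fun y => T (f y)) D y ∧ ∀ w, D w = T (df w) :=
  ⟨_, (LinearMap.toContinuousLinearMap (⟨⟨T, hadd⟩, hsmul⟩ : A →ₗ[ℝ] F)).hasFDerivAt.comp y hf,
    fun _ => rfl⟩

end Linear

theorem phiModel_eq_zero_iff {f : V →L[ℝ] V} {z : V} {ξ : V →L[ℝ] ℝ} :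
    phiModel f z ξ = 0 ↔ f = 0 ∧ z = 0 ∧ ξ = 0 := by
  constructor
  · intro h
    refine ⟨ContinuousLinearMap.ext fun v => ?_, ?_, ContinuousLinearMap.ext fun v => ?_⟩
    · have := congrArg (·.1.1) (DFunLike.congr_fun h ((v, 0), 0))
      simpa [phiModel_fst] using this
    -- The covector dt isolates z, up to sign, in the vector part.
    · have := congrArg (·.1.1) (DFunLike.congr_fun h (0, ContinuousLinearMap.snd ℝ V ℝ))
      simpa [phiModel_fst] using this
    · have := congrArg (fun a : Big (V × ℝ) => a.2 (0, 1)) (DFunLike.congr_fun h ((v, 0), 0))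
      simpa [phiModel_snd] using this
  · rintro ⟨rfl, rfl, rfl⟩
    refine ContinuousLinearMap.ext fun a =>
      Prod.ext (Prod.ext ?_ ?_) (ContinuousLinearMap.ext fun w => ?_)
    · simp [phiModel_fst]
    · exact (congrArg Prod.snd (phiModel_fst (0 : V →L[ℝ] V) 0 0 a)).trans (map_zero a.2)
    · refine (phiModel_snd (0 : V →L[ℝ] V) 0 0 a w).trans ?_
      have : a.2 ((0 : V), (0 : ℝ)) = 0 := map_zero a.2
      simp [this]

variable [FiniteDimensional ℝ V]

theorem _root_.ContDiffAt.phiModel {W : Type*} [NormedAddCommGroup W] [NormedSpace ℝ W]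
    {f : W → V →L[ℝ] V} {z : W → V} {ξ : W → V →L[ℝ] ℝ} {y : W} (hf : ContDiffAt ℝ ∞ f y)
    (hz : ContDiffAt ℝ ∞ z y) (hξ : ContDiffAt ℝ ∞ ξ y) :
    ContDiffAt ℝ ∞ (fun y => phiModel (f y) (z y) (ξ y)) y :=
  (hf.prodMk (hz.prodMk hξ)).linear_comp
    (T := fun p : (V →L[ℝ] V) × V × (V →L[ℝ] ℝ) => GenGeom.phiModel p.1 p.2.1 p.2.2)
    phiModel_add phiModel_smul

theorem _root_.HasFDerivAt.phiModel {W : Type*} [NormedAddCommGroup W] [NormedSpace ℝ W]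
    {f : W → V →L[ℝ] V} {z : W → V} {ξ : W → V →L[ℝ] ℝ} {y : W} {df : W →L[ℝ] V →L[ℝ] V}
    {dz : W →L[ℝ] V} {dξ : W →L[ℝ] V →L[ℝ] ℝ} (hf : HasFDerivAt f df y)
    (hz : HasFDerivAt z dz y) (hξ : HasFDerivAt ξ dξ y) :
    ∃ D : W →L[ℝ] Big (V × ℝ) →L[ℝ] Big (V × ℝ),
      HasFDerivAt (fun y => phiModel (f y) (z y) (ξ y)) D y ∧
        ∀ w, D w = phiModel (df w) (dz w) (dξ w) := by
  exact (hf.prodMk (hz.prodMk hξ)).linear_comp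
    (T := fun p : (V →L[ℝ] V) × V × (V →L[ℝ] ℝ) => GenGeom.phiModel p.1 p.2.1 p.2.2)
    phiModel_add phiModel_smul

omit [FiniteDimensional ℝ V] in
theorem hasFDerivAt_comp_fst {F : Type*} [NormedAddCommGroup F] [NormedSpace ℝ F] {f : V → F}
    {df : V →L[ℝ] F} {y : V} (h : HasFDerivAt f df y) (t : ℝ) :
    HasFDerivAt (fun p : V × ℝ => f p.1) (df.comp (ContinuousLinearMap.fst ℝ V ℝ)) (y, t) :=
  HasFDerivAt.comp (y, t) h hasFDerivAt_fst

end Model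

/-! ### Charts of M × ℝ -/

section Product

variable {E : Type*} [NormedAddCommGroup E] [NormedSpace ℝ E]
  {H : Type*} [TopologicalSpace H] {I : ModelWithCorners ℝ E H}
  {M : Type*} [TopologicalSpace M] [ChartedSpace H M]

theorem extChartAt_prod_real (p : M × ℝ) :
    extChartAt (I.prod 𝓘(ℝ, ℝ)) p = (extChartAt I p.1).prod (PartialEquiv.refl ℝ) := by
  rw [extChartAt_prod, extChartAt_model_space_eq_id]

theorem extChartAt_prod_real_symm_apply (p : M × ℝ) (y : E × ℝ) :
    (extChartAt (I.prod 𝓘(ℝ, ℝ)) p).symm y = ((extChartAt I p.1).symm y.1, y.2) := by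
  rw [extChartAt_prod_real]
  rfl

theorem extChartAt_prod_real_self (p : M × ℝ) :
    extChartAt (I.prod 𝓘(ℝ, ℝ)) p p = (extChartAt I p.1 p.1, p.2) := by
  rw [extChartAt_prod_real]
  rfl

theorem mem_extChartAt_prod_real_target {p : M × ℝ} {y : E × ℝ}
    (hy : y ∈ (extChartAt (I.prod 𝓘(ℝ, ℝ)) p).target) : y.1 ∈ (extChartAt I p.1).target := by
  rw [extChartAt_prod_real] at hy
  exact hy.1

variable [IsManifold I ∞ M] [I.Boundaryless]

/-- The chart of the product is the chart of M times the identity of ℝ, so its differential splits.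
-/
theorem frame_prod {p : M × ℝ} {y : E × ℝ}
    (hy : y ∈ (extChartAt (I.prod 𝓘(ℝ, ℝ)) p).target) (v : E × ℝ) :
    frame (I.prod 𝓘(ℝ, ℝ)) p y v = (frame I p.1 y.1 v.1, v.2) := by
  have : IsManifold I 1 M := isManifold_one I
  have h1 := (mdifferentiableWithinAt_extChartAt_symm (I := I)
    (mem_extChartAt_prod_real_target hy)).hasMFDerivWithinAt
  rw [I.range_eq_univ, hasMFDerivWithinAt_univ] at h1
  have h2 : HasMFDerivAt 𝓘(ℝ, E × ℝ) 𝓘(ℝ, E) Prod.fst y (ContinuousLinearMap.fst ℝ E ℝ) :=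
    hasFDerivAt_fst.hasMFDerivAt
  have h3 : HasMFDerivAt 𝓘(ℝ, E × ℝ) 𝓘(ℝ, ℝ) Prod.snd y (ContinuousLinearMap.snd ℝ E ℝ) :=
    hasFDerivAt_snd.hasMFDerivAt
  have h4 := (h1.comp y h2).prodMk h3
  have h5 : ⇑(extChartAt (I.prod 𝓘(ℝ, ℝ)) p).symm =
      fun y : E × ℝ => (((extChartAt I p.1).symm ∘ Prod.fst) y, Prod.snd y) :=
    funext (extChartAt_prod_real_symm_apply p)
  have h6 : mfderiv 𝓘(ℝ, E × ℝ) (I.prod 𝓘(ℝ, ℝ)) (extChartAt (I.prod 𝓘(ℝ, ℝ)) p).symm y v =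
      (frame I p.1 y.1 v.1, v.2) := by
    rw [h5, h4.mfderiv, frame, I.range_eq_univ]
    rfl
  refine Eq.trans ?_ h6
  rw [frame, (I.prod 𝓘(ℝ, ℝ)).range_eq_univ, mfderivWithin_univ]
  rfl

theorem coframe_prod {p : M × ℝ} {y : E × ℝ}
    (hy : y ∈ (extChartAt (I.prod 𝓘(ℝ, ℝ)) p).target) (v : E × ℝ) :
    coframe (I.prod 𝓘(ℝ, ℝ)) p y v = (coframe I p.1 y.1 v.1, v.2) := by
  refine Eq.trans ?_ (coframe_frame (I.prod 𝓘(ℝ, ℝ)) hy _)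
  rw [frame_prod hy, frame_coframe I (mem_extChartAt_prod_real_target hy)]

theorem bilinHat_prod {g : M → E →L[ℝ] E →L[ℝ] ℝ} {p : M × ℝ} {y : E × ℝ}
    (hy : y ∈ (extChartAt (I.prod 𝓘(ℝ, ℝ)) p).target) :
    bilinHat (I.prod 𝓘(ℝ, ℝ)) p (fun q : M × ℝ => prodBilin (g q.1)) y =
      prodBilin (bilinHat I p.1 g y.1) := by
  refine ContinuousLinearMap.ext fun v => ContinuousLinearMap.ext fun w => ?_
  rw [bilinHat_apply, frame_prod hy, frame_prod hy, extChartAt_prod_real_symm_apply]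
  rfl

theorem isChartRep_phiModel (f : M → E →L[ℝ] E) (z : M → E) (ξ : M → E →L[ℝ] ℝ) (p : M × ℝ) :
    IsChartRep (I.prod 𝓘(ℝ, ℝ)) p (fun q : M × ℝ => phiModel (f q.1) (z q.1) (ξ q.1))
      (fun y => phiModel (endHat I p.1 f y.1) (vecHat I p.1 z y.1) (formHat I p.1 ξ y.1)) := by
  filter_upwards [eventually_mem_target (I.prod 𝓘(ℝ, ℝ)) p] with y hy s
  have hy' := mem_extChartAt_prod_real_target hy
  have key : ∀ a : Big (E × ℝ), bigCoframe (I.prod 𝓘(ℝ, ℝ)) p y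
      (phiModel (f ((extChartAt I p.1).symm y.1)) (z ((extChartAt I p.1).symm y.1))
        (ξ ((extChartAt I p.1).symm y.1)) a) =
      phiModel (endHat I p.1 f y.1) (vecHat I p.1 z y.1) (formHat I p.1 ξ y.1)
        (bigCoframe (I.prod 𝓘(ℝ, ℝ)) p y a) := by
    intro a
    refine Prod.ext (Prod.ext ?_ ?_) (ContinuousLinearMap.ext fun w => ?_)
    · simp only [bigCoframe, coframe_prod hy, phiModel_fst, endHat, ContinuousLinearMap.comp_apply,
        frame_prod hy, frame_coframe I hy', map_sub, map_smul, map_zero, vecHat]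
    · simp only [bigCoframe, coframe_prod hy, phiModel_fst, ContinuousLinearMap.comp_apply,
        frame_prod hy, frame_coframe I hy', vecHat]
    · simp only [bigCoframe, coframe_prod hy, phiModel_snd, endHat, ContinuousLinearMap.comp_apply,
        frame_prod hy, frame_coframe I hy', formHat]
  have e : ((extChartAt (I.prod 𝓘(ℝ, ℝ)) p).symm y).1 = (extChartAt I p.1).symm y.1 :=
    congrArg Prod.fst (extChartAt_prod_real_symm_apply (I := I) p y)
  refine Eq.trans ?_ (key (s ((extChartAt (I.prod 𝓘(ℝ, ℝ)) p).symm y)))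
  rw [← e]
  rfl

end Product

/-! ### Conclusion on M × ℝ -/

namespace AlmostContactMetric

variable {E : Type*} [NormedAddCommGroup E] [NormedSpace ℝ E]
  {H : Type*} [TopologicalSpace H] {I : ModelWithCorners ℝ E H}
  {M : Type*} [TopologicalSpace M] [ChartedSpace H M] [IsManifold I ∞ M]
  (C : AlmostContactMetric I M)

theorem isScalarProd_prodBilin (q : M × ℝ) : IsScalarProd (prodBilin (C.γE q.1)) :=
  IsScalarProd.prodBilin ⟨(C.isContactAlg q.1).symm, (C.isContactAlg q.1).pos⟩

variable [I.Boundaryless]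

theorem bilinHat_prodBilin_eventuallyEq (p : M × ℝ) :
    (bilinHat (I.prod 𝓘(ℝ, ℝ)) p fun q : M × ℝ => prodBilin (C.γE q.1))
      =ᶠ[𝓝 (extChartAt (I.prod 𝓘(ℝ, ℝ)) p p)]
        fun y => prodBilin (bilinHat I p.1 C.γE y.1) := by
  filter_upwards [eventually_mem_target (I.prod 𝓘(ℝ, ℝ)) p] with y hy using bilinHat_prod hy

theorem exists_hasFDerivAt_prodBilin (p : M × ℝ) :
    ∃ D : E × ℝ →L[ℝ] E × ℝ →L[ℝ] E × ℝ →L[ℝ] ℝ,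
    HasFDerivAt (bilinHat (I.prod 𝓘(ℝ, ℝ)) p fun q : M × ℝ => prodBilin (C.γE q.1)) D
      (extChartAt (I.prod 𝓘(ℝ, ℝ)) p p) ∧ ∀ v a b, D v a b = C.dγ p.1 v.1 a.1 b.1 := by
  have e := C.bilinHat_prodBilin_eventuallyEq p
  rw [extChartAt_prod_real_self] at e ⊢
  have hg := hasFDerivAt_comp_fst (F := E →L[ℝ] E →L[ℝ] ℝ) (C.hasFDerivAt_γE p.1) p.2
  obtain ⟨D, hD, eD⟩ := hg.prodBilin
  exact ⟨D, hD.congr_of_eventuallyEq e, eD⟩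

theorem contDiffAt_prodBilin (p : M × ℝ) :
    ContDiffAt ℝ ∞ (bilinHat (I.prod 𝓘(ℝ, ℝ)) p fun q : M × ℝ => prodBilin (C.γE q.1))
      (extChartAt (I.prod 𝓘(ℝ, ℝ)) p p) := by
  have e := C.bilinHat_prodBilin_eventuallyEq p
  rw [extChartAt_prod_real_self] at e ⊢
  exact (ContDiffAt.prodBilin (ContDiffAt.fst'' (x := (extChartAt I p.1 p.1, p.2))
    (C.contDiffAt_γE p.1))).congr_of_eventuallyEq e

variable [FiniteDimensional ℝ E]

theorem contDiffAt_phiHat (p : M × ℝ) : ContDiffAt ℝ ∞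
    (fun y : E × ℝ => phiModel (endHat I p.1 C.FE y.1) (vecHat I p.1 C.ZE y.1)
      (formHat I p.1 C.ξE y.1)) (extChartAt (I.prod 𝓘(ℝ, ℝ)) p p) := by
  rw [extChartAt_prod_real_self]
  exact ContDiffAt.phiModel
    (ContDiffAt.fst'' (x := (extChartAt I p.1 p.1, p.2)) (C.contDiffAt_FE p.1))
    (ContDiffAt.fst'' (x := (extChartAt I p.1 p.1, p.2)) (C.contDiffAt_ZE p.1))
    (ContDiffAt.fst'' (x := (extChartAt I p.1 p.1, p.2)) (C.contDiffAt_ξE p.1))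

theorem exists_hasFDerivAt_phiHat (p : M × ℝ) : ∃ D : E × ℝ →L[ℝ] Big (E × ℝ) →L[ℝ] Big (E × ℝ),
    HasFDerivAt (fun y : E × ℝ => phiModel (endHat I p.1 C.FE y.1) (vecHat I p.1 C.ZE y.1)
      (formHat I p.1 C.ξE y.1)) D (extChartAt (I.prod 𝓘(ℝ, ℝ)) p p) ∧
      ∀ v, D v = phiModel (C.dF p.1 v.1) (C.dZ p.1 v.1) (C.dξ p.1 v.1) := by
  rw [extChartAt_prod_real_self]
  have hf := hasFDerivAt_comp_fst (C.hasFDerivAt_FE p.1) p.2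
  have hz := hasFDerivAt_comp_fst (C.hasFDerivAt_ZE p.1) p.2
  have hξ := hasFDerivAt_comp_fst (C.hasFDerivAt_ξE p.1) p.2
  obtain ⟨D, hD, eD⟩ := hf.phiModel hz hξ
  exact ⟨D, hD, eD⟩

/-- The product with `ℝ` is generalized Kähler if and only if the almost contact metric structure is
cosymplectic in the sense of Blair. -/
theorem isGenKahler_iff_isCosymplectic [T2Space M] :
    IsGenKahler (I.prod 𝓘(ℝ, ℝ)) (sharpOfMetric (I.prod 𝓘(ℝ, ℝ)) C.prodMetric) C.Phi0 ↔
      C.IsCosymplectic := by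
  obtain ⟨Γ, hΓ⟩ := C.exists_isChristoffel
  choose dΦ hd hdΦ using C.exists_hasFDerivAt_phiHat
  choose dB hdB edB using C.exists_hasFDerivAt_prodBilin
  have hg := C.isScalarProd_prodBilin
  have hrep := fun p : M × ℝ => isChartRep_phiModel (I := I) C.FE C.ZE C.ξE p
  have hS := isGenRiemannianMetric_sharp (I.prod 𝓘(ℝ, ℝ)) hg C.contDiffAt_prodBilin
  have hsm : SmoothBigEnd (I.prod 𝓘(ℝ, ℝ)) (M := M × ℝ)
      (fun q : M × ℝ => phiModel (C.FE q.1) (C.ZE q.1) (C.ξE q.1)) :=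
    smoothBigEnd_of_chartRep (I.prod 𝓘(ℝ, ℝ)) (M := M × ℝ)
      (Φ := fun q : M × ℝ => phiModel (C.FE q.1) (C.ZE q.1) (C.ξE q.1))
      fun p => ⟨_, hrep p, C.contDiffAt_phiHat p⟩
  have hΦ : IsGenAlmostComplex (I.prod 𝓘(ℝ, ℝ)) (M := M × ℝ)
      (fun q : M × ℝ => phiModel (C.FE q.1) (C.ZE q.1) (C.ξE q.1)) :=
    ⟨hsm, fun q a b => add_eq_zero_iff_eq_neg.2 (pair_phiModel _ _ _ a b),
      fun q a => phiModel_phiModel (C.isContactAlg q.1) a⟩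
  have hdS := fun p : M × ℝ => (((C.contDiffAt_prodBilin p).sharp (IsScalarProd.hat
    (I.prod 𝓘(ℝ, ℝ)) hg (mem_extChartAt_target p))).differentiableAt (by simp)).hasFDerivAt
  have main := isGenKahler_iff_parallel (I.prod 𝓘(ℝ, ℝ)) hΦ hS
    (fun q a => sharp_phiModel (C.isContactAlg q.1) a) hrep hd
    (fun p => isChartRep_sharp (I.prod 𝓘(ℝ, ℝ)) hg p) hdS (C := fun p => prodConn (Γ p.1))
    (fun p v w => by rw [prodConn_apply, prodConn_apply, (hΓ p.1).1])
    (fun p v => ?_) (fun p ε hε v => (hg p).exists_sharp_eq ε hε v)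
  -- `main` concerns the fiberwise models, which unfold to `C.Phi0` and to `sharpOfMetric` of the
  -- product metric.
  · refine Iff.trans main ?_
    rw [hΓ.isCosymplectic_iff]
    have key : ∀ (p : M × ℝ) v, nablaBig (prodConn (Γ p.1)) (phiModel (C.FE p.1) (C.ZE p.1)
        (C.ξE p.1)) (dΦ p) v = 0 ↔ nablaEnd (Γ p.1) (C.FE p.1) (C.dF p.1) v.1 = 0 ∧
        nablaVec (Γ p.1) (C.ZE p.1) (C.dZ p.1) v.1 = 0 ∧
        nablaForm (Γ p.1) (C.ξE p.1) (C.dξ p.1) v.1 = 0 := fun p v => by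
      rw [nablaBig_phiModel _ _ _ _ _ _ _ (hdΦ p), phiModel_eq_zero_iff]
    constructor
    · intro h x
      -- Nothing depends on t, so the slice t = 0 and directions tangent to M carry all the
      -- information.
      have h' := fun v => (key (x, 0) (v, 0)).1 (h (x, 0) (v, 0))
      exact ⟨LinearMap.ext fun v => (h' v).1, LinearMap.ext fun v => (h' v).2.1,
        LinearMap.ext fun v => (h' v).2.2⟩
    · intro h p v
      refine (key p v).2 ?_
      obtain ⟨h1, h2, h3⟩ := h p.1
      rw [h1, h2, h3]
      exact ⟨rfl, rfl, rfl⟩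
  -- The product connection is metric for γ + dt², so the generalized metric is parallel.
  · have h := nablaBig_sharp_eq_zero ((eventually_mem_target (I.prod 𝓘(ℝ, ℝ)) p).mono
      fun y hy => IsScalarProd.hat (I.prod 𝓘(ℝ, ℝ)) hg hy) (hdB p) (C := prodConn (Γ p.1))
      (fun v a b => ?_) (hdS p) v
    · rw [bilinHat_self] at h
      exact h
    · rw [edB, bilinHat_self, (hΓ p.1).2]
      simp [prodBilin_apply, prodConn_apply]

end AlmostContactMetric

end GenGeom

end

theorem proposition5p1 (m : ℕ) (M : Type*) [TopologicalSpace M] [T2Space M]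
    [ChartedSpace (EuclideanSpace ℝ (Fin m)) M] [IsManifold (𝓡 m) ∞ M]
    (C : GenGeom.AlmostContactMetric (𝓡 m) M) :
    GenGeom.IsGenKahler ((𝓡 m).prod 𝓘(ℝ, ℝ))
      (GenGeom.sharpOfMetric ((𝓡 m).prod 𝓘(ℝ, ℝ)) C.prodMetric) C.Phi0 ↔
    C.IsCosymplectic := by
  exact C.isGenKahler_iff_isCosymplectic
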